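/- Let $m\le n$ be positive integers with $m\mid n$, let $q\in\mathbb{C}$ be a primitive $m$-th root of $1$, and let $\zeta\in\mathbb{C}$ be a primitive $n$-th root of $1$ with $\zeta^{n/m}=q$. Let $$T(n,m,0)=\mathbb{C}\langle x,g\rangle/(x^m,\ g^n-1,\ gxg^{-1}-qx)$$ be the generalized Taft algebra, i.e. the Hopf algebra over $\mathbb{C}$ with $\Delta(g)=g\otimes g$, $\Delta(x)=x\otimes 1+g\otimes x$, $\epsilon(g)=1$, $\epsilon(x)=0$, $S(g)=g^{-1}$, $S(x)=-g^{-1}x$. Let $K=\mathbb{C}(u,v)$ be the field of rational functions in two variables and $$Q(n,m)=K\langle c,w\rangle/(c^n-u,\ w^n-v,\ cw-\zeta wc).$$ Then $Q(n,m)$ is a division algebra with center $K$ and $\dim_K Q(n,m)=n^2$. There is exactly one $\mathbb{C}$-linear $T(n,m,0)$-module algebra structure on $Q(n,m)$ with $$g\cdot c=qc,\qquad g\cdot w=\zeta w,\qquad x\cdot c=(1-q)c^2,\qquad x\cdot w=0.$$ This action is inner faithful (no nonzero Hopf ideal of $T(n,m,0)$ annihilates $Q(n,m)$). Its algebra of invariants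 $Q(n,m)^{T(n,m,0)}=\{a : h\cdot a=\epsilon(h)a\ \text{for all}\ h\in T(n,m,0)\}$ is the subfield $K(c^m)$. Finally, $Q(n,m)$ is $T(n,m,0)$-Galois over its invariants: with $H=T(n,m,0)$, $A=Q(n,m)$ and the $H^*$-coaction $a\mapsto\sum a_0\otimes a_1\in A\otimes H^*$ corresponding to the action (so $h\cdot a=\sum a_1(h)a_0$), the canonical map $A\otimes_{A^H}A\to A\otimes H^*$, $a\otimes a'\mapsto\sum a\,a'_0\otimes a'_1$, is bijective. -/

import Mathlib

open scoped TensorProduct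

/-! ### Actions of Hopf algebras on algebras -/

section HopfActions

variable (k H A : Type*) [Field k] [Ring H] [HopfAlgebra k H] [Ring A] [Algebra k A]

/-- An action of the Hopf algebra `H` on the algebra `A`, i.e. a left `H`-module algebra structure
on `A`: a `k`-linear left `H`-module structure on `A` with `h · 1 = ε(h) 1` and
`h · (a b) = ∑ (h₁ · a) (h₂ · b)`. -/
@[ext]
structure HopfAction where
  act : H →ₐ[k] Module.End k A
  act_one : ∀ h : H, act h 1 = algebraMap k A (Coalgebra.counit (R := k) h)
  act_mul : ∀ (h : H) (a b : A), act h (a * b) =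
    LinearMap.mul' k A (TensorProduct.map (act.toLinearMap.flip a) (act.toLinearMap.flip b)
      (Coalgebra.comul (R := k) h))

variable {k A}

/-- For a subalgebra `B ⊆ A`, the `k`-subspace of `A ⊗[k] A` spanned by the elements
`a b ⊗ a' - a ⊗ b a'` with `b ∈ B`. -/
def balancedRel (B : Subalgebra k A) : Submodule k (A ⊗[k] A) :=
  Submodule.span k {t | ∃ a a' : A, ∃ b ∈ B, t = (a * b) ⊗ₜ[k] a' - a ⊗ₜ[k] (b * a')}

/-- The tensor product `A ⊗_B A` over a (not necessarily commutative or central)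
subalgebra `B ⊆ A`. -/
abbrev BalancedTensor (B : Subalgebra k A) : Type _ := (A ⊗[k] A) ⧸ balancedRel B

variable {H}

namespace HopfAction

variable (ρ : HopfAction k H A)

/-- The action is inner faithful: no nonzero Hopf ideal of `H` annihilates `A`; equivalently, the
representation `H → End_k(A)` does not factor through a proper Hopf quotient of `H`. -/
def InnerFaithful : Prop :=
  ∀ I : Ideal H, I.IsTwoSided → I.IsHopfIdeal k → (∀ h ∈ I, ρ.act h = 0) → I = ⊥

lemma act_mul_of_invariant (h : H) {a : A}
    (ha : ∀ h : H, ρ.act h a = Coalgebra.counit (R := k) h • a) (b : A) :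
    ρ.act h (a * b) = a * ρ.act h b := by
  have e : ρ.act.toLinearMap.flip a = (Coalgebra.counit (R := k) (A := H)).smulRight a := by
    ext h; simp [ha]
  rw [ρ.act_mul, e]
  conv_rhs => rw [← Coalgebra.sum_counit_smul (Coalgebra.Repr.arbitrary k h)]
  conv_lhs => rw [← (Coalgebra.Repr.arbitrary k h).eq]
  simp [map_sum, Finset.mul_sum]

/-- The invariants `A^H = {a | h · a = ε(h) a for all h}`, a subalgebra of `A`. -/
def invariants : Subalgebra k A where
  carrier := {a | ∀ h : H, ρ.act h a = Coalgebra.counit (R := k) h • a}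
  mul_mem' := by
    intro a b ha hb h
    rw [ρ.act_mul_of_invariant h ha, hb h, mul_smul_comm]
  add_mem' := by
    intro a b ha hb h
    rw [map_add, ha h, hb h, smul_add]
  algebraMap_mem' := by
    intro r h
    rw [Algebra.algebraMap_eq_smul_one, map_smul, ρ.act_one, Algebra.algebraMap_eq_smul_one,
      smul_comm]

variable [Module.Finite k H]

/-- The right coaction `A → A ⊗ H*` of the dual Hopf algebra corresponding to the action of the
finite-dimensional Hopf algebra `H`. -/
noncomputable def coaction : A →ₗ[k] A ⊗[k] Module.Dual k H :=
  (TensorProduct.comm k (Module.Dual k H) A).toLinearMap ∘ₗ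
    (dualTensorHomEquiv k H A).symm.toLinearMap ∘ₗ ρ.act.toLinearMap.flip

/-- The coaction `a ↦ ∑ a₀ ⊗ a₁` is characterized by `h · a = ∑ a₁(h) a₀`. -/
lemma coaction_eq_iff (a : A) (t : A ⊗[k] Module.Dual k H) :
    ρ.coaction a = t ↔
      ∀ h, dualTensorHom k H A (TensorProduct.comm k A (Module.Dual k H) t) h = ρ.act h a := by
  have : ρ.coaction a = t ↔ (dualTensorHomEquiv k H A).symm (ρ.act.toLinearMap.flip a) =
      TensorProduct.comm k A (Module.Dual k H) t := by
    rw [← (TensorProduct.comm k A (Module.Dual k H)).injective.eq_iff]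
    simp [coaction]
  rw [this, LinearEquiv.symm_apply_eq, LinearMap.ext_iff]
  refine forall_congr' fun h => ?_
  rw [eq_comm]
  simp [dualTensorHomEquiv]

/-- The invariants of `H` are the coinvariants of `H*`. -/
lemma mem_invariants_iff_coaction (a : A) :
    a ∈ ρ.invariants ↔ ρ.coaction a = a ⊗ₜ[k] (Coalgebra.counit : H →ₗ[k] k) := by
  rw [coaction_eq_iff]
  refine forall_congr' fun h => ?_
  rw [eq_comm]
  simp

/-- The map `A ⊗[k] A → A ⊗ H*`, `a ⊗ a' ↦ (a ⊗ 1) · coaction a'`. -/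
noncomputable def preCan : A ⊗[k] A →ₗ[k] A ⊗[k] Module.Dual k H :=
  TensorProduct.lift
    ((LinearMap.lcomp k _ ρ.coaction) ∘ₗ (LinearMap.rTensorHom (Module.Dual k H)) ∘ₗ
      (LinearMap.mul k A))

lemma preCan_tmul (a a' : A) :
    ρ.preCan (a ⊗ₜ[k] a') =
      (LinearMap.mulLeft k a).rTensor (Module.Dual k H) (ρ.coaction a') := rfl

lemma coaction_mul_of_mem {b : A} (hb : b ∈ ρ.invariants) (a : A) :
    ρ.coaction (b * a) = (LinearMap.mulLeft k b).rTensor (Module.Dual k H) (ρ.coaction a) := by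
  rw [coaction_eq_iff]
  intro h
  rw [ρ.act_mul_of_invariant h hb, ← (ρ.coaction_eq_iff a _).1 rfl h]
  induction ρ.coaction a using TensorProduct.induction_on with
  | zero => simp
  | tmul x f => simp
  | add s t hs ht => simp only [map_add, LinearMap.add_apply, hs, ht, mul_add]

lemma balancedRel_le_ker : balancedRel ρ.invariants ≤ LinearMap.ker ρ.preCan := by
  refine Submodule.span_le.2 ?_
  rintro _ ⟨a, a', b, hb, rfl⟩
  rw [SetLike.mem_coe, LinearMap.mem_ker, map_sub, sub_eq_zero, preCan_tmul, preCan_tmul,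
    ρ.coaction_mul_of_mem hb, LinearMap.mulLeft_mul, LinearMap.rTensor_comp]
  rfl

/-- The canonical (Galois) map `A ⊗_{A^H} A → A ⊗ H*`. -/
noncomputable def can : BalancedTensor ρ.invariants →ₗ[k] A ⊗[k] Module.Dual k H :=
  (balancedRel ρ.invariants).liftQ ρ.preCan ρ.balancedRel_le_ker

/-- `A` is `H`-Galois over its invariants `A^H`: it is an `H*`-Galois extension of its
coinvariants, i.e. the canonical map `A ⊗_{A^H} A → A ⊗ H*` is bijective. -/
def IsHopfGalois : Prop := Function.Bijective ρ.can

end HopfAction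

end HopfActions

/-! ### The generalized Taft algebras `T(n, m, 0)` -/

section QBinomial

/-- Gaussian binomial coefficients. -/
noncomputable def qBinom (q : ℂ) : ℕ → ℕ → ℂ
  | _, 0 => 1
  | 0, _ + 1 => 0
  | N + 1, j + 1 => qBinom q N j + q ^ (j + 1) * qBinom q N (j + 1)

lemma qBinom_of_lt (q : ℂ) (N : ℕ) : ∀ j, N < j → qBinom q N j = 0 := by
  induction N with
  | zero => intro j hj; obtain ⟨j, rfl⟩ := Nat.exists_eq_succ_of_ne_zero hj.ne'; simp [qBinom]
  | succ N ih =>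
    intro j hj
    obtain ⟨j, rfl⟩ := Nat.exists_eq_succ_of_ne_zero (Nat.ne_of_gt (Nat.zero_lt_of_lt hj))
    simp [qBinom, ih j (by omega), ih (j + 1) (by omega)]

lemma geom_mul_qBinom (q : ℂ) (N : ℕ) : ∀ j,
    (∑ i ∈ Finset.range (j + 1), q ^ i) * qBinom q (N + 1) (j + 1) =
      (∑ i ∈ Finset.range (N + 1), q ^ i) * qBinom q N j := by
  have hs : ∀ j, ∑ i ∈ Finset.range (j + 1), q ^ i = q * ∑ i ∈ Finset.range j, q ^ i + 1 :=
    fun j => by rw [Finset.sum_range_succ', Finset.mul_sum]; simp [pow_succ']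
  induction N with
  | zero =>
    rintro (_ | j)
    · simp [qBinom]
    · simp [qBinom]
  | succ N ih =>
    rintro (_ | j)
    · have h0 := ih 0
      simp only [zero_add, Finset.range_one, Finset.sum_singleton, pow_zero, one_mul] at h0 ⊢
      have h1 : qBinom q (N + 1 + 1) 1 = 1 + q * qBinom q (N + 1) 1 := by simp [qBinom]
      have h2 : ∀ M, qBinom q M 0 = 1 := by intro M; cases M <;> simp [qBinom]
      rw [h1, h0, hs (N + 1), h2, h2]
      ring
    · rw [qBinom, mul_add, mul_left_comm, ih (j + 1), hs (j + 1), add_mul, mul_assoc, ih j,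
        hs (N + 1), add_mul, mul_assoc]
      conv_rhs => rw [qBinom]
      conv_lhs => rw [qBinom]
      ring

lemma add_pow_of_qComm {R : Type*} [Ring R] [Algebra ℂ R] {q : ℂ} {x y : R}
    (h : y * x = q • (x * y)) (N : ℕ) :
    (x + y) ^ N = ∑ p ∈ Finset.range (N + 1), qBinom q N p • (x ^ p * y ^ (N - p)) := by
  have hp : ∀ p, y * x ^ p = q ^ p • (x ^ p * y) := by
    intro p
    induction p with
    | zero => simp
    | succ p ih =>
      rw [pow_succ, ← mul_assoc, ih, smul_mul_assoc, mul_assoc, h, mul_smul_comm, smul_smul,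
        ← pow_succ, mul_assoc]
  induction N with
  | zero => simp [qBinom]
  | succ N ih =>
    rw [pow_succ', ih, add_mul, Finset.sum_range_succ' _ (N + 1)]
    have e1 : x * ∑ p ∈ Finset.range (N + 1), qBinom q N p • (x ^ p * y ^ (N - p)) =
        ∑ p ∈ Finset.range (N + 1), qBinom q N p • (x ^ (p + 1) * y ^ (N + 1 - (p + 1))) := by
      rw [Finset.mul_sum]
      refine Finset.sum_congr rfl fun p _ => ?_
      rw [mul_smul_comm, ← mul_assoc, ← pow_succ', Nat.add_sub_add_right]
    have e2 : y * ∑ p ∈ Finset.range (N + 1), qBinom q N p • (x ^ p * y ^ (N - p)) =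
        ∑ p ∈ Finset.range (N + 1),
          (q ^ (p + 1) * qBinom q N (p + 1)) • (x ^ (p + 1) * y ^ (N + 1 - (p + 1))) +
          qBinom q (N + 1) 0 • (x ^ 0 * y ^ (N + 1 - 0)) := by
      have e3 : y * ∑ p ∈ Finset.range (N + 1), qBinom q N p • (x ^ p * y ^ (N - p)) =
          ∑ p ∈ Finset.range (N + 1), (q ^ p * qBinom q N p) • (x ^ p * y ^ (N + 1 - p)) := by
        rw [Finset.mul_sum]
        refine Finset.sum_congr rfl fun p hp' => ?_
        have : p ≤ N := Nat.lt_succ_iff.1 (Finset.mem_range.1 hp')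
        rw [mul_smul_comm, ← mul_assoc, hp, smul_mul_assoc, mul_assoc, ← pow_succ', smul_smul,
          mul_comm, Nat.succ_sub this]
      rw [e3, Finset.sum_range_succ', Finset.sum_range_succ (n := N),
        qBinom_of_lt q N (N + 1) (by omega)]
      simp [qBinom]
    rw [e1, e2, ← add_assoc, ← Finset.sum_add_distrib]
    congr 1
    refine Finset.sum_congr rfl fun p _ => ?_
    rw [← add_smul, ← qBinom]

lemma qBinom_eq_zero {q : ℂ} {m : ℕ} (hq : IsPrimitiveRoot q m) {j : ℕ} (h0 : 0 < j)
    (hj : j < m) : qBinom q m j = 0 := by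
  obtain ⟨j, rfl⟩ := Nat.exists_eq_succ_of_ne_zero h0.ne'
  obtain ⟨m, rfl⟩ := Nat.exists_eq_succ_of_ne_zero (Nat.ne_of_gt (Nat.zero_lt_of_lt hj))
  have h := geom_mul_qBinom q m j
  rw [hq.geom_sum_eq_zero (by omega), zero_mul] at h
  refine (mul_eq_zero.1 h).resolve_left fun h1 => ?_
  have h2 := geom_sum_mul q (j + 1)
  rw [h1, zero_mul] at h2
  exact hq.pow_ne_one_of_pos_of_lt h0.ne' hj (sub_eq_zero.1 h2.symm)

lemma add_pow_eq_zero_of_qComm {R : Type*} [Ring R] [Algebra ℂ R] {q : ℂ} {m : ℕ}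
    (hq : IsPrimitiveRoot q m) {x y : R} (h : y * x = q • (x * y)) (hx : x ^ m = 0)
    (hy : y ^ m = 0) : (x + y) ^ m = 0 := by
  rw [add_pow_of_qComm h]
  refine Finset.sum_eq_zero fun p hp => ?_
  rcases Nat.eq_zero_or_pos p with rfl | h0
  · simp [hy]
  · rcases (Nat.lt_succ_iff.1 (Finset.mem_range.1 hp)).eq_or_lt with rfl | h1
    · simp [hx]
    · simp [qBinom_eq_zero hq h0 h1]

end QBinomial

/-- The generators `x`, `g`. -/
inductive TaftGen
  | x
  | g

/-- The defining relations `x ^ m = 0`, `g ^ n = 1`, `g x = q x g`. -/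
inductive TaftRel (n m : ℕ) (q : ℂ) : FreeAlgebra ℂ TaftGen → FreeAlgebra ℂ TaftGen → Prop
  | x_pow : TaftRel n m q (FreeAlgebra.ι ℂ TaftGen.x ^ m) 0
  | g_pow : TaftRel n m q (FreeAlgebra.ι ℂ TaftGen.g ^ n) 1
  | g_mul_x : TaftRel n m q (FreeAlgebra.ι ℂ TaftGen.g * FreeAlgebra.ι ℂ TaftGen.x)
      (q • (FreeAlgebra.ι ℂ TaftGen.x * FreeAlgebra.ι ℂ TaftGen.g))

/-- The generalized Taft algebra `T(n, m, 0) = ℂ⟨x, g⟩ / (x ^ m, g ^ n - 1, g x g⁻¹ - q x)`. -/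
def Taft (n m : ℕ) (q : ℂ) : Type := RingQuot (TaftRel n m q)

namespace Taft

variable {n m : ℕ} {q : ℂ}

noncomputable instance : Ring (Taft n m q) := inferInstanceAs (Ring (RingQuot (TaftRel n m q)))

noncomputable instance : Algebra ℂ (Taft n m q) :=
  inferInstanceAs (Algebra ℂ (RingQuot (TaftRel n m q)))

variable (n m q) in
/-- The quotient map from the free algebra. -/
noncomputable def mk : FreeAlgebra ℂ TaftGen →ₐ[ℂ] Taft n m q :=
  RingQuot.mkAlgHom ℂ (TaftRel n m q)

variable (n m q) in
/-- The generator `x`. -/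
noncomputable def x : Taft n m q := mk n m q (FreeAlgebra.ι ℂ TaftGen.x)

variable (n m q) in
/-- The generator `g`. -/
noncomputable def g : Taft n m q := mk n m q (FreeAlgebra.ι ℂ TaftGen.g)

lemma x_pow : x n m q ^ m = 0 := by
  have := RingQuot.mkAlgHom_rel ℂ (TaftRel.x_pow (n := n) (m := m) (q := q))
  rw [map_pow, map_zero] at this
  exact this

lemma g_pow : g n m q ^ n = 1 := by
  have := RingQuot.mkAlgHom_rel ℂ (TaftRel.g_pow (n := n) (m := m) (q := q))
  rw [map_pow, map_one] at this
  exact this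

lemma g_mul_x : g n m q * x n m q = q • (x n m q * g n m q) := by
  have := RingQuot.mkAlgHom_rel ℂ (TaftRel.g_mul_x (n := n) (m := m) (q := q))
  rw [map_smul, map_mul, map_mul] at this
  exact this

@[ext]
lemma algHom_ext {B : Type*} [Semiring B] [Algebra ℂ B] {f₁ f₂ : Taft n m q →ₐ[ℂ] B}
    (hx : f₁ (x n m q) = f₂ (x n m q)) (hg : f₁ (g n m q) = f₂ (g n m q)) : f₁ = f₂ := by
  refine RingQuot.ringQuot_ext' ℂ _ _ (FreeAlgebra.hom_ext (funext fun i => ?_))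
  cases i
  · exact hx
  · exact hg

/-- The universal property of the presentation. -/
noncomputable def lift {B : Type*} [Semiring B] [Algebra ℂ B] (X G : B) (hX : X ^ m = 0)
    (hG : G ^ n = 1) (hGX : G * X = q • (X * G)) : Taft n m q →ₐ[ℂ] B :=
  RingQuot.liftAlgHom ℂ ⟨FreeAlgebra.lift ℂ (fun i => TaftGen.casesOn i X G), by
    rintro _ _ (_ | _ | _)
    · simpa using hX
    · simpa using hG
    · simpa using hGX⟩

@[simp]
lemma lift_x {B : Type*} [Semiring B] [Algebra ℂ B] (X G : B) (hX : X ^ m = 0)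
    (hG : G ^ n = 1) (hGX : G * X = q • (X * G)) : lift X G hX hG hGX (x n m q) = X :=
  (RingQuot.liftAlgHom_mkAlgHom_apply ..).trans (by simp)

@[simp]
lemma lift_g {B : Type*} [Semiring B] [Algebra ℂ B] (X G : B) (hX : X ^ m = 0)
    (hG : G ^ n = 1) (hGX : G * X = q • (X * G)) : lift X G hX hG hGX (g n m q) = G :=
  (RingQuot.liftAlgHom_mkAlgHom_apply ..).trans (by simp)

@[elab_as_elim]
lemma induction {P : Taft n m q → Prop} (halg : ∀ r : ℂ, P (algebraMap ℂ _ r))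
    (hx : P (x n m q)) (hg : P (g n m q)) (hmul : ∀ a b, P a → P b → P (a * b))
    (hadd : ∀ a b, P a → P b → P (a + b)) (a : Taft n m q) : P a := by
  obtain ⟨a, rfl⟩ := RingQuot.mkAlgHom_surjective ℂ (TaftRel n m q) a
  induction a using FreeAlgebra.induction with
  | grade0 r => rw [AlgHom.commutes]; exact halg r
  | grade1 i => cases i; exacts [hx, hg]
  | mul a b ha hb => rw [map_mul]; exact hmul _ _ ha hb
  | add a b ha hb => rw [map_add]; exact hadd _ _ ha hb

/-- The algebra `T(n, m, 0)` is finite-dimensional, spanned by the `x ^ i g ^ j`. -/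
instance [hn : NeZero n] [hmn : Fact (m ∣ n)] : Module.Finite ℂ (Taft n m q) := by
  have hm : 0 < m := Nat.pos_of_dvd_of_pos hmn.out (NeZero.pos n)
  let S : Submodule ℂ (Taft n m q) := Submodule.span ℂ
    (Set.range fun p : Fin m × Fin n => x n m q ^ (p.1 : ℕ) * g n m q ^ (p.2 : ℕ))
  have mem : ∀ i j : ℕ, x n m q ^ i * g n m q ^ j ∈ S := by
    intro i j
    by_cases hi : i < m
    · have hj : g n m q ^ j = g n m q ^ (j % n) := by
        conv_lhs => rw [← Nat.mod_add_div j n, pow_add, pow_mul, g_pow, one_pow, mul_one]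
      rw [hj]
      exact Submodule.subset_span ⟨(⟨i, hi⟩, ⟨j % n, Nat.mod_lt _ (NeZero.pos n)⟩), rfl⟩
    · rw [← Nat.add_sub_cancel' (not_lt.1 hi), pow_add, x_pow, zero_mul, zero_mul]
      exact S.zero_mem
  have key : ∀ a : Taft n m q, ∀ s ∈ S, a * s ∈ S := by
    intro a
    induction a using Taft.induction with
    | halg r => intro s hs; rw [← Algebra.smul_def]; exact S.smul_mem _ hs
    | hx =>
      intro s hs
      refine Submodule.span_induction ?_ (by simp) ?_ ?_ hs
      · rintro _ ⟨p, rfl⟩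
        simp only [← mul_assoc, ← pow_succ']
        exact mem _ _
      · intro s t _ _ h1 h2; rw [mul_add]; exact S.add_mem h1 h2
      · intro r s _ h1; rw [mul_smul_comm]; exact S.smul_mem _ h1
    | hg =>
      have hp : ∀ p, g n m q * x n m q ^ p = q ^ p • (x n m q ^ p * g n m q) := by
        intro p
        induction p with
        | zero => simp
        | succ p ih =>
          rw [pow_succ, ← mul_assoc, ih, smul_mul_assoc, mul_assoc, g_mul_x, mul_smul_comm,
            smul_smul, ← pow_succ, mul_assoc]
      intro s hs
      refine Submodule.span_induction ?_ (by simp) ?_ ?_ hs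
      · rintro _ ⟨p, rfl⟩
        simp only [← mul_assoc, hp, smul_mul_assoc]
        rw [mul_assoc, ← pow_succ']
        exact S.smul_mem _ (mem _ _)
      · intro s t _ _ h1 h2; rw [mul_add]; exact S.add_mem h1 h2
      · intro r s _ h1; rw [mul_smul_comm]; exact S.smul_mem _ h1
    | hmul a b ha hb => intro s hs; rw [mul_assoc]; exact ha _ (hb _ hs)
    | hadd a b ha hb => intro s hs; rw [add_mul]; exact S.add_mem (ha _ hs) (hb _ hs)
  have top : S = ⊤ := by
    refine eq_top_iff.2 fun a _ => ?_
    have := key a 1 (by simpa using mem 0 0)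
    rwa [mul_one] at this
  exact ⟨top ▸ Submodule.fg_span (Set.finite_range _)⟩

/-- The counit `ε(x) = 0`, `ε(g) = 1`. -/
noncomputable def counitHom [NeZero n] [Fact (m ∣ n)] : Taft n m q →ₐ[ℂ] ℂ :=
  lift 0 1 (zero_pow (ne_zero_of_dvd_ne_zero (NeZero.ne n) (Fact.out : m ∣ n))) (one_pow n)
    (by simp)

/-- The comultiplication `Δ(x) = x ⊗ 1 + g ⊗ x`, `Δ(g) = g ⊗ g`: the element `g` is grouplike and
`x` is `(g, 1)`-skew primitive. -/
noncomputable def comulHom [hq : Fact (IsPrimitiveRoot q m)] :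
    Taft n m q →ₐ[ℂ] Taft n m q ⊗[ℂ] Taft n m q :=
  lift (x n m q ⊗ₜ 1 + g n m q ⊗ₜ x n m q) (g n m q ⊗ₜ g n m q)
    (add_pow_eq_zero_of_qComm hq.out
      (by simp [g_mul_x, TensorProduct.smul_tmul'])
      (by simp [Algebra.TensorProduct.tmul_pow, x_pow])
      (by simp [Algebra.TensorProduct.tmul_pow, x_pow]))
    (by simp [Algebra.TensorProduct.tmul_pow, g_pow, Algebra.TensorProduct.one_def])
    (by simp [g_mul_x, mul_add, add_mul, TensorProduct.smul_tmul'])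

noncomputable instance [NeZero n] [Fact (m ∣ n)] [Fact (IsPrimitiveRoot q m)] :
    Bialgebra ℂ (Taft n m q) :=
  Bialgebra.ofAlgHom comulHom counitHom
    (by
      ext <;> simp [comulHom, TensorProduct.add_tmul, TensorProduct.tmul_add, add_assoc,
        Algebra.TensorProduct.one_def])
    (by ext <;> simp [comulHom, counitHom])
    (by ext <;> simp [comulHom, counitHom])

section Antipode

lemma ginv_mul_g [NeZero n] : g n m q ^ (n - 1) * g n m q = 1 := by
  rw [← pow_succ, Nat.sub_add_cancel (NeZero.pos n), g_pow]

lemma g_mul_ginv [NeZero n] : g n m q * g n m q ^ (n - 1) = 1 := by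
  rw [← pow_succ', Nat.sub_add_cancel (NeZero.pos n), g_pow]

lemma x_mul_ginv [NeZero n] :
    x n m q * g n m q ^ (n - 1) = q • (g n m q ^ (n - 1) * x n m q) := by
  calc x n m q * g n m q ^ (n - 1)
      = g n m q ^ (n - 1) * (g n m q * x n m q) * g n m q ^ (n - 1) := by
        rw [← mul_assoc, ginv_mul_g, one_mul]
    _ = q • (g n m q ^ (n - 1) * x n m q) := by
        rw [g_mul_x, mul_smul_comm, smul_mul_assoc, mul_assoc, mul_assoc, g_mul_ginv, mul_one]

lemma ginv_mul_x_pow [NeZero n] (p : ℕ) :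
    ∃ r : ℂ, (g n m q ^ (n - 1) * x n m q) ^ p = r • ((g n m q ^ (n - 1)) ^ p * x n m q ^ p) := by
  have hx : ∀ p, ∃ r : ℂ,
      x n m q ^ p * g n m q ^ (n - 1) = r • (g n m q ^ (n - 1) * x n m q ^ p) := by
    intro p
    induction p with
    | zero => exact ⟨1, by simp⟩
    | succ p ih =>
      obtain ⟨r, hr⟩ := ih
      refine ⟨q * r, ?_⟩
      rw [pow_succ, mul_assoc, x_mul_ginv, mul_smul_comm, ← mul_assoc, hr, smul_mul_assoc,
        smul_smul, mul_assoc]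
  induction p with
  | zero => exact ⟨1, by simp⟩
  | succ p ih =>
    obtain ⟨r, hr⟩ := ih
    obtain ⟨s, hs⟩ := hx p
    refine ⟨r * s, ?_⟩
    rw [pow_succ (g n m q ^ (n - 1) * x n m q), hr, smul_mul_assoc, mul_assoc,
      ← mul_assoc (x n m q ^ p), hs, smul_mul_assoc, mul_smul_comm, smul_smul,
      pow_succ (g n m q ^ (n - 1)), pow_succ (x n m q)]
    simp only [mul_assoc]

/-- The antipode `S(g) = g⁻¹`, `S(x) = - g⁻¹ x`, as an anti-homomorphism. -/
noncomputable def antipodeHom [NeZero n] : Taft n m q →ₐ[ℂ] (Taft n m q)ᵐᵒᵖ :=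
  lift (MulOpposite.op (-(g n m q ^ (n - 1) * x n m q))) (MulOpposite.op (g n m q ^ (n - 1)))
    (by
      obtain ⟨r, hr⟩ := ginv_mul_x_pow (n := n) (m := m) (q := q) m
      rw [← MulOpposite.op_pow, neg_pow, hr, x_pow]
      simp)
    (by rw [← MulOpposite.op_pow, ← pow_mul, mul_comm, pow_mul, g_pow, one_pow, MulOpposite.op_one])
    (by
      rw [← MulOpposite.op_mul, ← MulOpposite.op_mul, ← MulOpposite.op_smul, neg_mul, mul_neg,
        mul_assoc, x_mul_ginv, mul_smul_comm, smul_neg])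

/-- The antipode as a linear map. -/
noncomputable def antipodeLin [NeZero n] : Taft n m q →ₗ[ℂ] Taft n m q :=
  (MulOpposite.opLinearEquiv ℂ).symm.toLinearMap ∘ₗ (antipodeHom (n := n)).toLinearMap

lemma antipodeLin_mul [NeZero n] (a b : Taft n m q) :
    antipodeLin (a * b) = antipodeLin b * antipodeLin a := by
  simp [antipodeLin]

lemma antipode_left_aux [NeZero n] (s t : Taft n m q ⊗[ℂ] Taft n m q) (r : ℂ)
    (hs : LinearMap.mul' ℂ _ (antipodeLin.rTensor _ s) = algebraMap ℂ _ r) :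
    LinearMap.mul' ℂ _ (antipodeLin.rTensor _ (s * t)) =
      algebraMap ℂ _ r * LinearMap.mul' ℂ _ (antipodeLin.rTensor _ t) := by
  have key : ∀ u v : Taft n m q, LinearMap.mul' ℂ _ (antipodeLin.rTensor _ (s * u ⊗ₜ[ℂ] v)) =
      antipodeLin u * LinearMap.mul' ℂ _ (antipodeLin.rTensor _ s) * v := by
    clear hs
    intro u v
    induction s using TensorProduct.induction_on with
    | zero => simp
    | tmul y z => simp [antipodeLin_mul, mul_assoc]
    | add s s' h h' => rw [add_mul, map_add, map_add, h, h', map_add, map_add, mul_add, add_mul]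
  induction t using TensorProduct.induction_on with
  | zero => simp
  | add t t' h h' => rw [mul_add, map_add, map_add, h, h', map_add, map_add, mul_add]
  | tmul u v =>
    rw [key, hs, ← Algebra.commutes, mul_assoc]
    simp

lemma antipode_right_aux [NeZero n] (s t : Taft n m q ⊗[ℂ] Taft n m q) (r : ℂ)
    (ht : LinearMap.mul' ℂ _ (antipodeLin.lTensor _ t) = algebraMap ℂ _ r) :
    LinearMap.mul' ℂ _ (antipodeLin.lTensor _ (s * t)) =
      LinearMap.mul' ℂ _ (antipodeLin.lTensor _ s) * algebraMap ℂ _ r := by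
  have key : ∀ u v : Taft n m q, LinearMap.mul' ℂ _ (antipodeLin.lTensor _ (u ⊗ₜ[ℂ] v * t)) =
      u * LinearMap.mul' ℂ _ (antipodeLin.lTensor _ t) * antipodeLin v := by
    clear ht
    intro u v
    induction t using TensorProduct.induction_on with
    | zero => simp
    | tmul y z => simp [antipodeLin_mul, mul_assoc]
    | add s s' h h' => rw [mul_add, map_add, map_add, h, h', map_add, map_add, mul_add, add_mul]
  induction s using TensorProduct.induction_on with
  | zero => simp
  | add t t' h h' => rw [add_mul, map_add, map_add, h, h', map_add, map_add, add_mul]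
  | tmul u v =>
    rw [key, ht, mul_assoc, Algebra.commutes]
    simp [mul_assoc]

lemma antipodeLin_one [NeZero n] : antipodeLin (1 : Taft n m q) = 1 := by
  simp [antipodeLin]

lemma antipodeLin_x [NeZero n] : antipodeLin (x n m q) = -(g n m q ^ (n - 1) * x n m q) := by
  simp [antipodeLin, antipodeHom]

lemma antipodeLin_g [NeZero n] : antipodeLin (g n m q) = g n m q ^ (n - 1) := by
  simp [antipodeLin, antipodeHom]

variable [NeZero n] [Fact (m ∣ n)] [Fact (IsPrimitiveRoot q m)]

lemma comul_x : Coalgebra.comul (R := ℂ) (x n m q) = x n m q ⊗ₜ 1 + g n m q ⊗ₜ x n m q :=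
  lift_x ..

lemma comul_g : Coalgebra.comul (R := ℂ) (g n m q) = g n m q ⊗ₜ g n m q :=
  lift_g ..

lemma counit_x : Coalgebra.counit (R := ℂ) (x n m q) = 0 :=
  lift_x ..

lemma counit_g : Coalgebra.counit (R := ℂ) (g n m q) = 1 :=
  lift_g ..

lemma antipode_left (a : Taft n m q) :
    LinearMap.mul' ℂ _ (antipodeLin.rTensor _ (Coalgebra.comul (R := ℂ) a)) =
      algebraMap ℂ _ (Coalgebra.counit (R := ℂ) a) := by
  induction a using Taft.induction with
  | halg r =>
    rw [Bialgebra.comul_algebraMap, Bialgebra.counit_algebraMap, Algebra.algebraMap_eq_smul_one,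
      Algebra.algebraMap_eq_smul_one, Algebra.TensorProduct.one_def]
    simp [antipodeLin_one]
  | hx => simp [comul_x, counit_x, antipodeLin_x, antipodeLin_g]
  | hg => simp [comul_g, counit_g, antipodeLin_g, ginv_mul_g]
  | hmul a b ha hb =>
    rw [Bialgebra.comul_mul, Bialgebra.counit_mul, map_mul (algebraMap ℂ (Taft n m q))]
    rw [antipode_left_aux _ _ _ ha, hb]
  | hadd a b ha hb => simp only [map_add, ha, hb]

lemma antipode_right (a : Taft n m q) :
    LinearMap.mul' ℂ _ (antipodeLin.lTensor _ (Coalgebra.comul (R := ℂ) a)) =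
      algebraMap ℂ _ (Coalgebra.counit (R := ℂ) a) := by
  induction a using Taft.induction with
  | halg r =>
    rw [Bialgebra.comul_algebraMap, Bialgebra.counit_algebraMap, Algebra.algebraMap_eq_smul_one,
      Algebra.algebraMap_eq_smul_one, Algebra.TensorProduct.one_def]
    simp [antipodeLin_one]
  | hx => simp [comul_x, counit_x, antipodeLin_x, antipodeLin_one, ← mul_assoc, g_mul_ginv]
  | hg => simp [comul_g, counit_g, antipodeLin_g, g_mul_ginv]
  | hmul a b ha hb =>
    rw [Bialgebra.comul_mul, Bialgebra.counit_mul, map_mul (algebraMap ℂ (Taft n m q))]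
    rw [antipode_right_aux _ _ _ hb, ha]
  | hadd a b ha hb => simp only [map_add, ha, hb]

noncomputable instance : HopfAlgebra ℂ (Taft n m q) where
  antipode := antipodeLin
  mul_antipode_rTensor_comul := LinearMap.ext antipode_left
  mul_antipode_lTensor_comul := LinearMap.ext antipode_right

end Antipode

end Taft

/-! ### The cyclic algebra `Q(n, m)` -/

/-- The field of rational functions `ℂ(u, v)`. -/
abbrev RatUV : Type := FractionRing (MvPolynomial (Fin 2) ℂ)

namespace RatUV

/-- The variable `u`. -/
noncomputable def u : RatUV := algebraMap (MvPolynomial (Fin 2) ℂ) RatUV (MvPolynomial.X 0)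

/-- The variable `v`. -/
noncomputable def v : RatUV := algebraMap (MvPolynomial (Fin 2) ℂ) RatUV (MvPolynomial.X 1)

end RatUV

/-- The generators `c`, `w`. -/
inductive CyclicGen
  | c
  | w

/-- The defining relations `c ^ n = u`, `w ^ n = v`, `c w = ζ w c`. -/
inductive CyclicRel (n : ℕ) (ζ : ℂ) :
    FreeAlgebra RatUV CyclicGen → FreeAlgebra RatUV CyclicGen → Prop
  | c_pow : CyclicRel n ζ (FreeAlgebra.ι RatUV CyclicGen.c ^ n) (algebraMap RatUV _ RatUV.u)
  | w_pow : CyclicRel n ζ (FreeAlgebra.ι RatUV CyclicGen.w ^ n) (algebraMap RatUV _ RatUV.v)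
  | c_mul_w : CyclicRel n ζ (FreeAlgebra.ι RatUV CyclicGen.c * FreeAlgebra.ι RatUV CyclicGen.w)
      (algebraMap ℂ RatUV ζ • (FreeAlgebra.ι RatUV CyclicGen.w * FreeAlgebra.ι RatUV CyclicGen.c))

/-- The cyclic algebra `ℂ(u, v)⟨c, w⟩ / (c ^ n - u, w ^ n - v, c w - ζ w c)`. -/
def CyclicAlg (n : ℕ) (ζ : ℂ) : Type := RingQuot (CyclicRel n ζ)

namespace CyclicAlg

variable (n : ℕ) (ζ : ℂ)

noncomputable instance : Ring (CyclicAlg n ζ) := inferInstanceAs (Ring (RingQuot (CyclicRel n ζ)))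

noncomputable instance : Algebra RatUV (CyclicAlg n ζ) :=
  inferInstanceAs (Algebra RatUV (RingQuot (CyclicRel n ζ)))

noncomputable instance : Algebra ℂ (CyclicAlg n ζ) :=
  ((algebraMap RatUV (CyclicAlg n ζ)).comp (algebraMap ℂ RatUV)).toAlgebra'
    fun r a => Algebra.commutes (algebraMap ℂ RatUV r) a

instance : IsScalarTower ℂ RatUV (CyclicAlg n ζ) := IsScalarTower.of_algebraMap_eq fun _ => rfl

/-- The generator `c`. -/
noncomputable def c : CyclicAlg n ζ :=
  RingQuot.mkAlgHom RatUV (CyclicRel n ζ) (FreeAlgebra.ι RatUV CyclicGen.c)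

/-- The generator `w`. -/
noncomputable def w : CyclicAlg n ζ :=
  RingQuot.mkAlgHom RatUV (CyclicRel n ζ) (FreeAlgebra.ι RatUV CyclicGen.w)

end CyclicAlg

/-! ### Generalities -/

/-! The monomials `c ^ i * w ^ j` diagonalise everything. For `i, j < n` they form a `ℂ(u,
v)`-basis: they are units and simultaneous eigenvectors, with distinct pairs of eigenvalues, of the
automorphisms rescaling `c` and `w`, and the algebra is nonzero because clock and shift matrices
represent it. For all `i, j ∈ ℕ` they are independent over `ℂ` and span a quantum plane, which has
no zero divisors. Clearing denominators, `Q(n, m)` is a domain; being finite over a field, it is a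
division algebra.

Let `G` be the automorphism `c ↦ q c`, `w ↦ ζ w`. The element `x` acts as the inner `G`-derivation
`a ↦ c a - G(a) c`, which sends `c ^ i * w ^ j` to `(1 - q ^ i) c ^ (i + 1) * w ^ j`. The relations
of the Taft algebra and the invariants can be read off from this formula. Uniqueness holds because
two actions agree on a subalgebra closed under inverses.

For the Galois property (`taftAction_isHopfGalois`), the `m n` elements `c ^ (i + 1) * w ^ j` with
`i < m`, `j < n` span `Q` over the invariants. Letting `x ^ a * g ^ b` act on them gives a system
that is triangular in `i` and Vandermonde in `j`, so no nonzero left combination of them is killed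
by the canonical map (`eq_zero_of_sum_mul_act_eq_zero`). A dimension count gives surjectivity. A
Galois action is faithful, hence inner faithful. -/

section Vandermonde

variable {k V ι : Type*} [Field k] [AddCommGroup V] [Module k V]

/-- The invertibility of a Vandermonde matrix, with vector coefficients. -/
lemma eq_zero_of_sum_pow_smul_eq_zero (s : Finset ι) {μ : ι → k} (hμ : Set.InjOn μ s) (y : ι → V)
    (h : ∀ b : ℕ, ∑ i ∈ s, μ i ^ b • y i = 0) : ∀ i ∈ s, y i = 0 := by
  classical
  -- By linearity the hypothesis on powers extends to all polynomials; a Lagrange basis polynomial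
  -- then isolates one vector.
  have hp : ∀ p : Polynomial k, ∑ i ∈ s, p.eval (μ i) • y i = 0 := by
    intro p
    simp only [Polynomial.eval_eq_sum, Polynomial.sum, Finset.sum_smul]
    rw [Finset.sum_comm]
    refine Finset.sum_eq_zero fun b _ => ?_
    simp only [mul_smul, ← Finset.smul_sum, h, smul_zero]
  intro i hi
  have := hp (Lagrange.basis s μ i)
  rw [Finset.sum_eq_single_of_mem i hi fun j hj hji => by
    rw [Lagrange.eval_basis_of_ne hji.symm hj, zero_smul], Lagrange.eval_basis_self hμ hi,
    one_smul] at this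
  exact this

/-- Eigenvectors for distinct eigenvalues are independent. -/
lemma eq_zero_of_sum_eigenvectors_eq_zero [Fintype ι] (T : Module.End k V) {μ : ι → k}
    (hμ : Function.Injective μ) {y : ι → V} (hy : ∀ i, T (y i) = μ i • y i)
    (h : ∑ i, y i = 0) (i : ι) : y i = 0 := by
  refine eq_zero_of_sum_pow_smul_eq_zero Finset.univ hμ.injOn y (fun b => ?_) i (Finset.mem_univ i)
  have hb : ∀ j, μ j ^ b • y j = (T ^ b) (y j) := by
    intro j
    induction b with
    | zero => simp
    | succ b ih => rw [pow_succ' T, Module.End.mul_apply, ← ih, map_smul, hy, smul_smul, pow_succ]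
  simp only [hb, ← map_sum, h, map_zero]

end Vandermonde

lemma IsPrimitiveRoot.injective_pow_fin {R : Type*} [CommMonoid R] {ζ : R} {n : ℕ}
    (hζ : IsPrimitiveRoot ζ n) : Function.Injective fun i : Fin n => ζ ^ (i : ℕ) :=
  fun i j h => Fin.ext (hζ.pow_inj i.2 j.2 h)

lemma RatUV.u_ne_zero : RatUV.u ≠ 0 := by
  rw [RatUV.u, Ne, FaithfulSMul.algebraMap_eq_zero_iff]
  exact MvPolynomial.X_ne_zero 0

lemma RatUV.v_ne_zero : RatUV.v ≠ 0 := by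
  rw [RatUV.v, Ne, FaithfulSMul.algebraMap_eq_zero_iff]
  exact MvPolynomial.X_ne_zero 1

/-! ### The basis of the cyclic algebra -/

namespace CyclicAlg

variable {n : ℕ} {ζ : ℂ}

lemma c_pow : c n ζ ^ n = algebraMap RatUV _ RatUV.u := by
  have := RingQuot.mkAlgHom_rel RatUV (CyclicRel.c_pow (n := n) (ζ := ζ))
  rw [map_pow, AlgHom.commutes] at this
  exact this

lemma w_pow : w n ζ ^ n = algebraMap RatUV _ RatUV.v := by
  have := RingQuot.mkAlgHom_rel RatUV (CyclicRel.w_pow (n := n) (ζ := ζ))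
  rw [map_pow, AlgHom.commutes] at this
  exact this

lemma c_mul_w : c n ζ * w n ζ = ζ • (w n ζ * c n ζ) := by
  have := RingQuot.mkAlgHom_rel RatUV (CyclicRel.c_mul_w (n := n) (ζ := ζ))
  rw [map_smul, map_mul, map_mul] at this
  rw [← algebraMap_smul RatUV ζ]
  exact this

/-- The universal property of the presentation. -/
noncomputable def lift {B : Type*} [Semiring B] [Algebra RatUV B] (X Y : B)
    (hX : X ^ n = algebraMap _ _ RatUV.u) (hY : Y ^ n = algebraMap _ _ RatUV.v)
    (hXY : X * Y = algebraMap ℂ RatUV ζ • (Y * X)) : CyclicAlg n ζ →ₐ[RatUV] B :=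
  RingQuot.liftAlgHom RatUV ⟨FreeAlgebra.lift RatUV (fun i => CyclicGen.casesOn i X Y), by
    rintro _ _ (_ | _ | _)
    · simpa using hX
    · simpa using hY
    · rw [map_smul]
      simpa using hXY⟩

section lift

variable {B : Type*} [Semiring B] [Algebra RatUV B] (X Y : B)
    (hX : X ^ n = algebraMap _ _ RatUV.u) (hY : Y ^ n = algebraMap _ _ RatUV.v)
    (hXY : X * Y = algebraMap ℂ RatUV ζ • (Y * X))

@[simp]
lemma lift_c : lift X Y hX hY hXY (c n ζ) = X :=
  (RingQuot.liftAlgHom_mkAlgHom_apply ..).trans (by simp)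

@[simp]
lemma lift_w : lift X Y hX hY hXY (w n ζ) = Y :=
  (RingQuot.liftAlgHom_mkAlgHom_apply ..).trans (by simp)

end lift

@[elab_as_elim]
lemma induction {P : CyclicAlg n ζ → Prop} (halg : ∀ r : RatUV, P (algebraMap RatUV _ r))
    (hc : P (c n ζ)) (hw : P (w n ζ)) (hmul : ∀ a b, P a → P b → P (a * b))
    (hadd : ∀ a b, P a → P b → P (a + b)) (a : CyclicAlg n ζ) : P a := by
  obtain ⟨a, rfl⟩ := RingQuot.mkAlgHom_surjective RatUV (CyclicRel n ζ) a
  induction a using FreeAlgebra.induction with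
  | grade0 r => rw [AlgHom.commutes]; exact halg r
  | grade1 i => cases i; exacts [hc, hw]
  | mul a b ha hb => rw [map_mul]; exact hmul _ _ ha hb
  | add a b ha hb => rw [map_add]; exact hadd _ _ ha hb

variable (n ζ) in
/-- The monomial `c ^ i * w ^ j`. -/
noncomputable def mon (i j : ℕ) : CyclicAlg n ζ := c n ζ ^ i * w n ζ ^ j

lemma c_mul_mon (i j : ℕ) : c n ζ * mon n ζ i j = mon n ζ (i + 1) j := by
  rw [mon, mon, ← mul_assoc, pow_succ']

lemma mon_mul_w (i j : ℕ) : mon n ζ i j * w n ζ = mon n ζ i (j + 1) := by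
  rw [mon, mon, mul_assoc, pow_succ]

lemma c_pow_mul_w_pow (i j : ℕ) :
    c n ζ ^ i * w n ζ ^ j = ζ ^ (i * j) • (w n ζ ^ j * c n ζ ^ i) := by
  have h1 : ∀ j, c n ζ * w n ζ ^ j = ζ ^ j • (w n ζ ^ j * c n ζ) := by
    intro j
    induction j with
    | zero => simp
    | succ j ih =>
      rw [pow_succ, ← mul_assoc, ih, smul_mul_assoc, mul_assoc, c_mul_w, mul_smul_comm, smul_smul,
        ← pow_succ, mul_assoc]
  induction i with
  | zero => simp
  | succ i ih =>
    rw [pow_succ', mul_assoc, ih, mul_smul_comm, ← mul_assoc, h1, smul_mul_assoc, smul_smul,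
      ← pow_add, mul_assoc, ← pow_succ', Nat.succ_mul]

lemma w_pow_mul_c_pow (hζ : ζ ≠ 0) (i j : ℕ) :
    w n ζ ^ j * c n ζ ^ i = (ζ⁻¹) ^ (i * j) • mon n ζ i j := by
  rw [mon, c_pow_mul_w_pow, smul_smul, ← mul_pow, inv_mul_cancel₀ hζ, one_pow, one_smul]

lemma mon_mul_mon (hζ : ζ ≠ 0) (i j i' j' : ℕ) :
    mon n ζ i j * mon n ζ i' j' = (ζ⁻¹) ^ (i' * j) • mon n ζ (i + i') (j + j') := by
  rw [mon, mon, mul_assoc, ← mul_assoc (w n ζ ^ j), w_pow_mul_c_pow hζ, smul_mul_assoc,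
    mul_smul_comm, mon, mon, pow_add, pow_add]
  simp only [mul_assoc]

/-- Since `c ^ n` and `w ^ n` are scalars, exponents matter only modulo `n`, up to powers of `u` and
`v`. -/
lemma mon_add_mul (i j s t : ℕ) :
    mon n ζ (i + n * s) (j + n * t) = (RatUV.u ^ s * RatUV.v ^ t) • mon n ζ i j := by
  rw [mon, mon, pow_add, pow_mul, c_pow, pow_add, pow_mul, w_pow, ← map_pow, ← map_pow,
    ← Algebra.commutes, ← Algebra.commutes, ← Algebra.smul_def, ← Algebra.smul_def,
    smul_mul_smul_comm]

variable (n ζ) in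
/-- The algebra automorphism multiplying `c` and `w` by powers of `ζ`. -/
noncomputable def scale (hζ : IsPrimitiveRoot ζ n) (k l : ℕ) :
    CyclicAlg n ζ →ₐ[RatUV] CyclicAlg n ζ :=
  lift (ζ ^ k • c n ζ) (ζ ^ l • w n ζ)
    (by rw [smul_pow, ← pow_mul, mul_comm, pow_mul, hζ.pow_eq_one, one_pow, one_smul, c_pow])
    (by rw [smul_pow, ← pow_mul, mul_comm, pow_mul, hζ.pow_eq_one, one_pow, one_smul, w_pow])
    (by rw [smul_mul_smul_comm, smul_mul_smul_comm, algebraMap_smul, c_mul_w, smul_comm,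
      mul_comm (ζ ^ k)])

section scale

variable (hζ : IsPrimitiveRoot ζ n)

@[simp] lemma scale_c (k l : ℕ) : scale n ζ hζ k l (c n ζ) = ζ ^ k • c n ζ := lift_c ..

@[simp] lemma scale_w (k l : ℕ) : scale n ζ hζ k l (w n ζ) = ζ ^ l • w n ζ := lift_w ..

lemma scale_mon (k l i j : ℕ) :
    scale n ζ hζ k l (mon n ζ i j) = ((ζ ^ k) ^ i * (ζ ^ l) ^ j) • mon n ζ i j := by
  simp [mon, smul_pow, smul_smul, mul_comm]

end scale

variable [NeZero n]

lemma isUnit_c : IsUnit (c n ζ) := by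
  refine (isUnit_pow_iff (NeZero.ne n)).1 ?_
  rw [c_pow]
  exact (isUnit_iff_ne_zero.2 RatUV.u_ne_zero).map _

lemma isUnit_w : IsUnit (w n ζ) := by
  refine (isUnit_pow_iff (NeZero.ne n)).1 ?_
  rw [w_pow]
  exact (isUnit_iff_ne_zero.2 RatUV.v_ne_zero).map _

lemma isUnit_mon (i j : ℕ) : IsUnit (mon n ζ i j) := (isUnit_c.pow i).mul (isUnit_w.pow j)

/-- The clock and shift matrices show that the cyclic algebra is not trivial. -/
lemma nontrivial (hζ : IsPrimitiveRoot ζ n) : Nontrivial (CyclicAlg n ζ) := by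
  let L := AlgebraicClosure RatUV
  obtain ⟨s, hs⟩ := IsAlgClosed.exists_pow_nat_eq (algebraMap RatUV L RatUV.u) (NeZero.pos n)
  obtain ⟨t, ht⟩ := IsAlgClosed.exists_pow_nat_eq (algebraMap RatUV L RatUV.v) (NeZero.pos n)
  let z : L := algebraMap RatUV L (algebraMap ℂ RatUV ζ)
  have hz : z ^ n = 1 := by simp only [z, ← map_pow, hζ.pow_eq_one, map_one]
  -- `χ` is the character of `ZMod n` with `χ 1 = ζ`. The clock `X` multiplies by `s χ(-i)` and the
  -- shift `Y` moves `i` to `i + 1`; the sign gives `X Y = ζ Y X`.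
  let χ := AddChar.zmodChar n hz
  let X : Module.End RatUV (ZMod n → L) :=
    { toFun := fun f i => s * χ (-i) * f i
      map_add' := fun f g => by ext; simp [mul_add]
      map_smul' := fun r f => by ext; simp }
  let Y : Module.End RatUV (ZMod n → L) :=
    { toFun := fun f i => t * f (i + 1)
      map_add' := fun f g => by ext; simp [mul_add]
      map_smul' := fun r f => by ext; simp }
  have hX : ∀ (k : ℕ) (f : ZMod n → L) (i : ZMod n), (X ^ k) f i = s ^ k * χ (-(k * i)) * f i := by
    intro k
    induction k with
    | zero => intro f i; simp
    | succ k ih =>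
      intro f i
      rw [pow_succ', Module.End.mul_apply]
      change s * χ (-i) * (X ^ k) f i = _
      rw [ih, show -(((k + 1 : ℕ) : ZMod n) * i) = -i + -(k * i) by push_cast; ring,
        AddChar.map_add_eq_mul]
      ring
  have hY : ∀ (k : ℕ) (f : ZMod n → L) (i : ZMod n), (Y ^ k) f i = t ^ k * f (i + k) := by
    intro k
    induction k with
    | zero => intro f i; simp
    | succ k ih =>
      intro f i
      rw [pow_succ', Module.End.mul_apply]
      change t * (Y ^ k) f (i + 1) = _
      rw [ih, show i + ((k + 1 : ℕ) : ZMod n) = i + 1 + k by push_cast; ring]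
      ring
  have hχ : χ 1 = z := by
    have := AddChar.zmodChar_apply' hz 1
    simpa using this
  refine (lift (n := n) (ζ := ζ) X Y ?_ ?_ ?_).toRingHom.domain_nontrivial
  · refine LinearMap.ext fun f => funext fun i => ?_
    rw [hX, hs]
    simp [Algebra.smul_def]
  · refine LinearMap.ext fun f => funext fun i => ?_
    rw [hY, ht]
    simp [Algebra.smul_def]
  · refine LinearMap.ext fun f => funext fun i => ?_
    change s * χ (-i) * (t * f (i + 1)) = algebraMap ℂ RatUV ζ • (t * (s * χ (-(i + 1)) * f (i + 1)))
    rw [Algebra.smul_def, show -i = 1 + -(i + 1) by ring, AddChar.map_add_eq_mul, hχ]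
    simp only [z]
    ring

/-- `scale 1 0` has eigenvalue `ζ ^ i` on the monomial `(i, j)` and separates the values of `i`;
then `scale 0 1`, with eigenvalue `ζ ^ j`, separates the values of `j`. -/
lemma linearIndependent_mon (hζ : IsPrimitiveRoot ζ n) :
    LinearIndependent RatUV fun p : Fin n × Fin n => mon n ζ p.1 p.2 := by
  have hz : IsPrimitiveRoot (algebraMap ℂ RatUV ζ) n :=
    hζ.map_of_injective (algebraMap ℂ RatUV).injective
  have := nontrivial hζ
  rw [Fintype.linearIndependent_iff]
  intro a ha
  rw [Fintype.sum_prod_type] at ha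
  have h1 := eq_zero_of_sum_eigenvectors_eq_zero (scale n ζ hζ 1 0).toLinearMap
    hz.injective_pow_fin (fun i => by
      rw [map_sum, Finset.smul_sum]
      refine Finset.sum_congr rfl fun j _ => ?_
      rw [map_smul, AlgHom.toLinearMap_apply, scale_mon, smul_comm, ← map_pow, algebraMap_smul]
      simp) ha
  rintro ⟨i, j⟩
  have h2 := eq_zero_of_sum_eigenvectors_eq_zero (scale n ζ hζ 0 1).toLinearMap
    hz.injective_pow_fin (fun j => by
      rw [map_smul, AlgHom.toLinearMap_apply, scale_mon, smul_comm, ← map_pow, algebraMap_smul]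
      simp) (h1 i) j
  exact (smul_eq_zero_iff_left (isUnit_mon _ _).ne_zero).1 h2

lemma mon_mem_span (i j : ℕ) : mon n ζ i j ∈
    Submodule.span RatUV (Set.range fun p : Fin n × Fin n => mon n ζ p.1 p.2) := by
  rw [← Nat.mod_add_div i n, ← Nat.mod_add_div j n, mon_add_mul]
  exact Submodule.smul_mem _ _ (Submodule.subset_span
    ⟨(⟨i % n, Nat.mod_lt _ (NeZero.pos n)⟩, ⟨j % n, Nat.mod_lt _ (NeZero.pos n)⟩), rfl⟩)

/-- The span is closed under products and contains the scalars and both generators. -/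
lemma span_mon (hζ : ζ ≠ 0) :
    Submodule.span RatUV (Set.range fun p : Fin n × Fin n => mon n ζ p.1 p.2) = ⊤ := by
  set S := Submodule.span RatUV (Set.range fun p : Fin n × Fin n => mon n ζ p.1 p.2) with hS
  have hmul : ∀ a ∈ S, ∀ b ∈ S, a * b ∈ S := by
    intro a ha b hb
    have := Submodule.mul_mem_mul ha hb
    rw [hS, Submodule.span_mul_span] at this
    refine Submodule.span_le.2 ?_ this
    rintro _ ⟨_, ⟨p, rfl⟩, _, ⟨r, rfl⟩, rfl⟩
    simp only [mon_mul_mon hζ]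
    rw [← algebraMap_smul RatUV]
    exact S.smul_mem _ (mon_mem_span _ _)
  have hm : ∀ i j, c n ζ ^ i * w n ζ ^ j ∈ S := mon_mem_span
  clear_value S
  refine eq_top_iff.2 fun a _ => ?_
  induction a using CyclicAlg.induction with
  | halg r =>
    rw [Algebra.algebraMap_eq_smul_one]
    refine S.smul_mem _ ?_
    simpa using hm 0 0
  | hc => simpa using hm 1 0
  | hw => simpa using hm 0 1
  | hmul a b ha hb => exact hmul a (ha trivial) b (hb trivial)
  | hadd a b ha hb => exact S.add_mem (ha trivial) (hb trivial)

variable (n ζ) in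
/-- The basis of monomials `c ^ i * w ^ j` with `i, j < n`. -/
noncomputable def monBasis (hζ : IsPrimitiveRoot ζ n) :
    Module.Basis (Fin n × Fin n) RatUV (CyclicAlg n ζ) :=
  Module.Basis.mk (linearIndependent_mon hζ) (span_mon (hζ.ne_zero (NeZero.ne n))).ge

lemma monBasis_apply (hζ : IsPrimitiveRoot ζ n) (p : Fin n × Fin n) :
    monBasis n ζ hζ p = mon n ζ p.1 p.2 := by
  simp [monBasis]

lemma finrank_eq (hζ : IsPrimitiveRoot ζ n) : Module.finrank RatUV (CyclicAlg n ζ) = n ^ 2 := by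
  rw [Module.finrank_eq_card_basis (monBasis n ζ hζ)]
  simp [sq]

lemma moduleFinite (hζ : IsPrimitiveRoot ζ n) : Module.Finite RatUV (CyclicAlg n ζ) :=
  .of_basis (monBasis n ζ hζ)

lemma exists_eq_sum_mon (hζ : IsPrimitiveRoot ζ n) (a : CyclicAlg n ζ) :
    ∃ r : Fin n × Fin n → RatUV, a = ∑ p, r p • mon n ζ p.1 p.2 :=
  ⟨fun p => (monBasis n ζ hζ).repr a p, by
    conv_lhs => rw [← (monBasis n ζ hζ).sum_repr a]
    simp [monBasis_apply]⟩

/-- If the coefficients are scaled by `e` and this gives zero, then they vanish unless `e` does. -/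
lemma coeff_eq_zero_of_sum_smul_eq_zero (hζ : IsPrimitiveRoot ζ n) {r : Fin n × Fin n → RatUV}
    {e : Fin n × Fin n → ℂ} (h : ∑ p, r p • e p • mon n ζ p.1 p.2 = 0) {p : Fin n × Fin n}
    (hp : e p ≠ 0) : r p = 0 := by
  have := Fintype.linearIndependent_iff.1 (linearIndependent_mon hζ)
    (fun p => r p * algebraMap ℂ RatUV (e p)) (by simpa only [mul_smul, algebraMap_smul] using h) p
  simpa [hp] using this

/-- Moving `w` past `c ^ i * w ^ j` costs `ζ⁻¹ ^ i`, and moving `c` costs `ζ⁻¹ ^ j`. Only the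
monomial `(0, 0)` commutes with both. -/
lemma isCentral (hζ : IsPrimitiveRoot ζ n) : Algebra.IsCentral RatUV (CyclicAlg n ζ) := by
  have h0 := hζ.ne_zero (NeZero.ne n)
  refine ⟨fun a ha => ?_⟩
  rw [Subalgebra.mem_center_iff] at ha
  obtain ⟨r, rfl⟩ := exists_eq_sum_mon hζ a
  have key : ∀ p : Fin n × Fin n, p ≠ 0 → r p = 0 := by
    intro p hp
    have hc := ha (c n ζ)
    have hw := ha (w n ζ)
    have ec : ∀ i j, mon n ζ i j * c n ζ = c n ζ * ((ζ⁻¹) ^ j • mon n ζ i j) := by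
      intro i j
      have h1 := mon_mul_mon (n := n) h0 i j 1 0
      rw [mul_smul_comm, c_mul_mon]
      simpa [mon] using h1
    have ew : ∀ i j, w n ζ * mon n ζ i j = ((ζ⁻¹) ^ i • mon n ζ i j) * w n ζ := by
      intro i j
      have h1 := mon_mul_mon (n := n) h0 0 1 i j
      rw [smul_mul_assoc, mon_mul_w, add_comm j]
      simpa [mon] using h1
    have hinv : IsPrimitiveRoot ζ⁻¹ n := hζ.inv
    by_cases h2 : p.2 = 0
    · have h1 : p.1 ≠ 0 := fun h1 => hp (Prod.ext h1 h2)
      refine coeff_eq_zero_of_sum_smul_eq_zero hζ (e := fun p => (ζ⁻¹) ^ (p.1 : ℕ) - 1) ?_ (p := p)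
        (sub_ne_zero.2 (hinv.pow_ne_one_of_pos_of_lt (fun h => h1 (Fin.ext h)) p.1.2))
      refine isUnit_w.mul_right_cancel ?_
      rw [zero_mul]
      simp only [sub_smul, smul_sub, Finset.sum_sub_distrib, sub_mul, one_smul]
      rw [← hw, sub_eq_zero]
      simp only [Finset.mul_sum, Finset.sum_mul, mul_smul_comm, ew, smul_mul_assoc]
    · refine coeff_eq_zero_of_sum_smul_eq_zero hζ (e := fun p => (ζ⁻¹) ^ (p.2 : ℕ) - 1) ?_ (p := p)
        (sub_ne_zero.2 (hinv.pow_ne_one_of_pos_of_lt (fun h => h2 (Fin.ext h)) p.2.2))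
      refine isUnit_c.mul_left_cancel ?_
      rw [mul_zero]
      simp only [sub_smul, smul_sub, Finset.sum_sub_distrib, mul_sub, one_smul]
      rw [hc, sub_eq_zero]
      simp only [Finset.mul_sum, Finset.sum_mul, mul_smul_comm, ec, smul_mul_assoc]
  rw [Finset.sum_eq_single_of_mem 0 (Finset.mem_univ _) fun p _ hp => by rw [key p hp, zero_smul]]
  rw [Algebra.mem_bot]
  exact ⟨r 0, by simp [mon, Algebra.algebraMap_eq_smul_one]⟩

end CyclicAlg

/-! ### The cyclic algebra is a division algebra -/

lemma RatUV.linearIndependent_pow_mul_pow :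
    LinearIndependent ℂ fun p : ℕ × ℕ => RatUV.u ^ p.1 * RatUV.v ^ p.2 := by
  have h1 := ((MvPolynomial.basisMonomials (Fin 2) ℂ).linearIndependent.map'
    (Algebra.linearMap (MvPolynomial (Fin 2) ℂ) RatUV |>.restrictScalars ℂ)
    (LinearMap.ker_eq_bot.2 (FaithfulSMul.algebraMap_injective _ _))).comp
    (fun p : ℕ × ℕ => Finsupp.single 0 p.1 + Finsupp.single 1 p.2) (by
      intro p r h
      have h0 := DFunLike.congr_fun h 0
      have h1 := DFunLike.congr_fun h 1
      simp at h0 h1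
      exact Prod.ext h0 h1)
  have h2 : (fun p : ℕ × ℕ => RatUV.u ^ p.1 * RatUV.v ^ p.2) = fun p => algebraMap _ RatUV
      (MvPolynomial.basisMonomials (Fin 2) ℂ (Finsupp.single 0 p.1 + Finsupp.single 1 p.2)) := by
    funext p
    rw [MvPolynomial.coe_basisMonomials, RatUV.u, RatUV.v, ← map_pow, ← map_pow, ← map_mul,
      MvPolynomial.X_pow_eq_monomial, MvPolynomial.X_pow_eq_monomial, MvPolynomial.monomial_mul,
      mul_one]
  rw [h2]
  exact h1

namespace CyclicAlg

variable {n : ℕ} {ζ : ℂ}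

variable (n ζ) in
/-- The subspace spanned over `ℂ` by the monomials `c ^ i * w ^ j`. -/
noncomputable def polySpan : Submodule ℂ (CyclicAlg n ζ) :=
  Submodule.span ℂ (Set.range fun p : ℕ × ℕ => mon n ζ p.1 p.2)

/-- Multiplication by `u` or `v` raises an exponent by `n`, so it sends monomials to monomials. -/
lemma algebraMap_smul_mon_mem_polySpan (P : MvPolynomial (Fin 2) ℂ) (i j : ℕ) :
    algebraMap _ RatUV P • mon n ζ i j ∈ polySpan n ζ := by
  induction P using MvPolynomial.induction_on generalizing i j with
  | C a =>
    rw [← MvPolynomial.algebraMap_eq, ← IsScalarTower.algebraMap_apply, algebraMap_smul]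
    exact Submodule.smul_mem _ _ (Submodule.subset_span ⟨(i, j), rfl⟩)
  | add P R hP hR => rw [map_add, add_smul]; exact Submodule.add_mem _ (hP i j) (hR i j)
  | mul_X P k hP =>
    rw [map_mul, mul_smul]
    fin_cases k
    · have := mon_add_mul (n := n) (ζ := ζ) i j 1 0
      rw [pow_zero, mul_one (_ ^ 1), pow_one] at this
      change _ • RatUV.u • _ ∈ _
      exact this ▸ hP _ _
    · have := mon_add_mul (n := n) (ζ := ζ) i j 0 1
      rw [pow_zero, one_mul, pow_one] at this
      change _ • RatUV.v • _ ∈ _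
      exact this ▸ hP _ _

variable [NeZero n]

/-- Division of the exponents by `n` writes each monomial as `u ^ s * v ^ t` times a reduced one.
Products of a family of scalars independent over `ℂ` with a family independent over `ℂ(u, v)` are
independent over `ℂ`. -/
lemma linearIndependent_mon_nat (hζ : IsPrimitiveRoot ζ n) :
    LinearIndependent ℂ fun p : ℕ × ℕ => mon n ζ p.1 p.2 := by
  have h := (linearIndependent_smul RatUV.linearIndependent_pow_mul_pow
    (linearIndependent_mon hζ)).comp
    (fun p : ℕ × ℕ => ((p.1 / n, p.2 / n), ((⟨p.1 % n, Nat.mod_lt _ (NeZero.pos n)⟩,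
      ⟨p.2 % n, Nat.mod_lt _ (NeZero.pos n)⟩) : Fin n × Fin n))) (by
      rintro ⟨i, j⟩ ⟨i', j'⟩ h
      simp only [Prod.mk.injEq, Fin.mk.injEq] at h
      refine Prod.ext ?_ ?_
      · rw [← Nat.mod_add_div i n, ← Nat.mod_add_div i' n, h.1.1, h.2.1]
      · rw [← Nat.mod_add_div j n, ← Nat.mod_add_div j' n, h.1.2, h.2.2])
  convert h using 2 with p
  simp only [Function.comp_apply]
  rw [← mon_add_mul, Nat.mod_add_div, Nat.mod_add_div]

/-- There are no zero divisors in the quantum plane: look at the unique leading monomial of a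
product. -/
lemma mul_ne_zero_of_mem_polySpan (hζ : IsPrimitiveRoot ζ n) {a b : CyclicAlg n ζ}
    (ha : a ∈ polySpan n ζ) (hb : b ∈ polySpan n ζ) (ha0 : a ≠ 0) (hb0 : b ≠ 0) : a * b ≠ 0 := by
  have h0 := hζ.ne_zero (NeZero.ne n)
  rw [polySpan, Finsupp.mem_span_range_iff_exists_finsupp] at ha hb
  obtain ⟨f, rfl⟩ := ha
  obtain ⟨g, rfl⟩ := hb
  have hf : f.support.Nonempty := by
    rw [Finsupp.support_nonempty_iff]; rintro rfl; simp at ha0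
  have hg : g.support.Nonempty := by
    rw [Finsupp.support_nonempty_iff]; rintro rfl; simp at hb0
  -- `p + r` is reached by only one pair from the two supports, so its coefficient in the product,
  -- computed in `F`, is a single nonzero term.
  obtain ⟨p, hp, r, hr, hpr⟩ := UniqueSums.uniqueAdd_of_nonempty hf hg
  intro h
  let F : (ℕ × ℕ) →₀ ℂ := ∑ s ∈ f.support, ∑ t ∈ g.support,
    Finsupp.single (s + t) (f s * g t * (ζ⁻¹) ^ (t.1 * s.2))
  have hF : Finsupp.linearCombination ℂ (fun p : ℕ × ℕ => mon n ζ p.1 p.2) F = 0 := by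
    rw [← h, Finsupp.sum, Finsupp.sum, Finset.sum_mul_sum]
    simp only [F, map_sum, Finsupp.linearCombination_single]
    refine Finset.sum_congr rfl fun s _ => Finset.sum_congr rfl fun t _ => ?_
    rw [smul_mul_smul_comm, mon_mul_mon h0, smul_smul, Prod.fst_add, Prod.snd_add]
  have hF0 : F = 0 := (linearIndependent_mon_nat hζ) (by rw [hF, map_zero])
  have hval : F (p + r) = f p * g r * (ζ⁻¹) ^ (r.1 * p.2) := by
    simp only [F, Finsupp.finsetSum_apply]
    rw [Finset.sum_eq_single_of_mem p hp, Finset.sum_eq_single_of_mem r hr]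
    · simp
    · intro t ht htr
      refine Finsupp.single_eq_of_ne fun e => htr (hpr hp ht e.symm).2
    · intro s hs hsp
      refine Finset.sum_eq_zero fun t ht => ?_
      refine Finsupp.single_eq_of_ne fun e => hsp (hpr hs ht e.symm).1
  rw [hF0, Finsupp.zero_apply] at hval
  exact mul_ne_zero (mul_ne_zero (Finsupp.mem_support_iff.1 hp) (Finsupp.mem_support_iff.1 hr))
    (pow_ne_zero _ (inv_ne_zero h0)) hval.symm

/-- The scalar is a common denominator of the coefficients. -/
lemma exists_smul_mem_polySpan (hζ : IsPrimitiveRoot ζ n) (a : CyclicAlg n ζ) :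
    ∃ r : RatUV, r ≠ 0 ∧ r • a ∈ polySpan n ζ := by
  obtain ⟨f, rfl⟩ := exists_eq_sum_mon hζ a
  obtain ⟨b, hb⟩ := IsLocalization.exist_integer_multiples_of_finite
    (nonZeroDivisors (MvPolynomial (Fin 2) ℂ)) f
  refine ⟨algebraMap _ RatUV (b : MvPolynomial (Fin 2) ℂ),
    IsFractionRing.to_map_ne_zero_of_mem_nonZeroDivisors b.2, ?_⟩
  rw [Finset.smul_sum]
  refine Submodule.sum_mem _ fun p _ => ?_
  obtain ⟨P, hP⟩ := hb p
  rw [smul_smul, ← Algebra.smul_def]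
  rw [← hP]
  exact algebraMap_smul_mon_mem_polySpan _ _ _

lemma noZeroDivisors (hζ : IsPrimitiveRoot ζ n) : NoZeroDivisors (CyclicAlg n ζ) := by
  refine ⟨fun {a b} h => ?_⟩
  by_contra! hab
  obtain ⟨r, hr, hra⟩ := exists_smul_mem_polySpan hζ a
  obtain ⟨s, hs, hsb⟩ := exists_smul_mem_polySpan hζ b
  refine mul_ne_zero_of_mem_polySpan hζ hra hsb (smul_ne_zero hr hab.1) (smul_ne_zero hs hab.2) ?_
  rw [smul_mul_smul_comm, h, smul_zero]

/-- In a domain that is finite over a field every nonzero element is integral over that field, hence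
invertible. -/
lemma isUnit_of_ne_zero (hζ : IsPrimitiveRoot ζ n) {a : CyclicAlg n ζ} (ha : a ≠ 0) :
    IsUnit a := by
  have := noZeroDivisors hζ
  have := nontrivial hζ
  have := moduleFinite hζ
  have := Algebra.IsIntegral.of_finite RatUV (CyclicAlg n ζ)
  have := NoZeroDivisors.to_isDomain (CyclicAlg n ζ)
  exact (Algebra.IsIntegral.isIntegral (R := RatUV) a).isUnit ha

end CyclicAlg

/-! ### Constructing and comparing actions of the Taft algebra -/

namespace Taft

variable {n m : ℕ} {q : ℂ} [NeZero n] [Fact (m ∣ n)] [Fact (IsPrimitiveRoot q m)]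
  {A : Type*} [Ring A] [Algebra ℂ A]

/-- An action of the Taft algebra is given by a pair of operators, an algebra endomorphism `G` and
a `G`-derivation `X`, satisfying the defining relations. -/
noncomputable def actionOfSkewDerivation (X : Module.End ℂ A) (G : A →ₐ[ℂ] A) (hX : X ^ m = 0)
    (hG : G.toLinearMap ^ n = 1) (hGX : G.toLinearMap * X = q • (X * G.toLinearMap))
    (hmul : ∀ a b, X (a * b) = X a * b + G a * X b) : HopfAction ℂ (Taft n m q) A where
  act := lift X G.toLinearMap hX hG hGX
  act_one h := by
    have hX1 : X 1 = 0 := by simpa using hmul 1 1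
    induction h using Taft.induction with
    | halg r =>
      rw [AlgHom.commutes, Bialgebra.counit_algebraMap, Module.algebraMap_end_apply,
        Algebra.algebraMap_eq_smul_one]
    | hx => rw [lift_x, counit_x, hX1, map_zero]
    | hg => simp [counit_g]
    | hmul a b ha hb =>
      rw [map_mul, Module.End.mul_apply, hb, Algebra.algebraMap_eq_smul_one, map_smul, ha,
        Bialgebra.counit_mul, map_mul, Algebra.smul_def, Algebra.commutes]
    | hadd a b ha hb => rw [map_add, LinearMap.add_apply, ha, hb, map_add, map_add]
  act_mul h := by
    set ρ := lift X G.toLinearMap hX hG hGX with hρ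
    -- `D h` is the operator of `Δ(h)` on `A ⊗ A`. Since `D` is multiplicative in `h`, the
    -- compatibility with products `key` passes from the generators to all `h`.
    let D : Taft n m q →ₐ[ℂ] Module.End ℂ (A ⊗[ℂ] A) :=
      (Module.endTensorEndAlgHom (R := ℂ) (S := ℂ) (A := ℂ)).comp
        ((Algebra.TensorProduct.map ρ ρ).comp (Bialgebra.comulAlgHom ℂ (Taft n m q)))
    have hD : ∀ (f f' : Module.End ℂ A) (a b : A),
        Module.endTensorEndAlgHom (R := ℂ) (S := ℂ) (A := ℂ) (f ⊗ₜ[ℂ] f') (a ⊗ₜ[ℂ] b) =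
          f a ⊗ₜ[ℂ] f' b := fun _ _ _ _ => rfl
    have key : ∀ t, ρ h (LinearMap.mul' ℂ A t) = LinearMap.mul' ℂ A (D h t) := by
      induction h using Taft.induction with
      | halg r => intro t; simp [AlgHom.commutes]
      | hx =>
        intro t
        induction t using TensorProduct.induction_on with
        | zero => simp
        | tmul a b => simp [D, hρ, comul_x, hmul, hD]
        | add s t hs ht => simp only [map_add, hs, ht]
      | hg =>
        intro t
        induction t using TensorProduct.induction_on with
        | zero => simp
        | tmul a b => simp [D, hρ, comul_g, hD]
        | add s t hs ht => simp only [map_add, hs, ht]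
      | hmul a b ha hb =>
        intro t
        rw [map_mul, map_mul, Module.End.mul_apply, Module.End.mul_apply, hb, ha]
      | hadd a b ha hb =>
        intro t
        rw [map_add, map_add, LinearMap.add_apply, LinearMap.add_apply, ha, hb, map_add]
    intro a b
    have h1 := key (a ⊗ₜ b)
    rw [LinearMap.mul'_apply] at h1
    rw [h1]
    congr 1
    simp only [D, AlgHom.comp_apply, Bialgebra.comulAlgHom_apply]
    induction Coalgebra.comul (R := ℂ) h using TensorProduct.induction_on with
    | zero => simp
    | tmul s t => simp [hD]
    | add s t hs ht => simp only [map_add, LinearMap.add_apply, hs, ht]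

section actionOfSkewDerivation

variable (X : Module.End ℂ A) (G : A →ₐ[ℂ] A) (hX : X ^ m = 0) (hG : G.toLinearMap ^ n = 1)
  (hGX : G.toLinearMap * X = q • (X * G.toLinearMap))
  (hmul : ∀ a b, X (a * b) = X a * b + G a * X b)

lemma actionOfSkewDerivation_x (a : A) :
    (actionOfSkewDerivation X G hX hG hGX hmul).act (x n m q) a = X a :=
  LinearMap.congr_fun (lift_x X G.toLinearMap hX hG hGX) a

lemma actionOfSkewDerivation_g (a : A) :
    (actionOfSkewDerivation X G hX hG hGX hmul).act (g n m q) a = G a :=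
  LinearMap.congr_fun (lift_g X G.toLinearMap hX hG hGX) a

end actionOfSkewDerivation

variable (ρ : HopfAction ℂ (Taft n m q) A)

lemma act_g_mul (a b : A) : ρ.act (g n m q) (a * b) = ρ.act (g n m q) a * ρ.act (g n m q) b := by
  simp [ρ.act_mul, comul_g]

lemma act_x_mul (a b : A) :
    ρ.act (x n m q) (a * b) = ρ.act (x n m q) a * b + ρ.act (g n m q) a * ρ.act (x n m q) b := by
  simp [ρ.act_mul, comul_x]

lemma act_g_one : ρ.act (g n m q) 1 = 1 := by simp [ρ.act_one, counit_g]

lemma act_x_one : ρ.act (x n m q) 1 = 0 := by simp [ρ.act_one, counit_x]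

/-- The elements on which two actions agree. -/
noncomputable def eqLocus (ρ ρ' : HopfAction ℂ (Taft n m q) A) : Subalgebra ℂ A where
  carrier := {a | ρ.act (g n m q) a = ρ'.act (g n m q) a ∧ ρ.act (x n m q) a = ρ'.act (x n m q) a}
  mul_mem' := by
    rintro a b ⟨h1, h2⟩ ⟨h3, h4⟩
    exact ⟨by rw [act_g_mul, act_g_mul, h1, h3], by rw [act_x_mul, act_x_mul, h1, h2, h4]⟩
  add_mem' := by
    rintro a b ⟨h1, h2⟩ ⟨h3, h4⟩
    exact ⟨by rw [map_add, map_add, h1, h3], by rw [map_add, map_add, h2, h4]⟩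
  algebraMap_mem' r := by
    refine ⟨?_, ?_⟩ <;> simp [Algebra.algebraMap_eq_smul_one, HopfAction.act_one]

lemma mem_eqLocus {ρ ρ' : HopfAction ℂ (Taft n m q) A} {a : A} : a ∈ eqLocus ρ ρ' ↔
    ρ.act (g n m q) a = ρ'.act (g n m q) a ∧ ρ.act (x n m q) a = ρ'.act (x n m q) a := Iff.rfl

/-- Applying `g` and `x` to `a * b = 1` determines `g · b` and `x · b` from `g · a` and `x · a`,
because `g · a` is a unit. This carries agreement of two actions from polynomials to rational
functions. -/
lemma mem_eqLocus_of_mul_eq_one {ρ ρ' : HopfAction ℂ (Taft n m q) A} {a b : A} (hab : a * b = 1)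
    (hba : b * a = 1) (ha : a ∈ eqLocus ρ ρ') : b ∈ eqLocus ρ ρ' := by
  rw [mem_eqLocus] at ha ⊢
  have hu : IsUnit (ρ.act (g n m q) a) := by
    refine ⟨⟨_, ρ.act (g n m q) b, ?_, ?_⟩, rfl⟩
    · rw [← act_g_mul, hab, act_g_one]
    · rw [← act_g_mul, hba, act_g_one]
  refine ⟨hu.mul_left_cancel ?_, hu.mul_left_cancel ?_⟩
  · rw [← act_g_mul, hab, ha.1, ← act_g_mul, hab, act_g_one, act_g_one]
  · have h1 := act_x_mul ρ a b
    have h2 := act_x_mul ρ' a b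
    rw [hab, act_x_one] at h1 h2
    rw [← ha.1, ← ha.2] at h2
    exact add_left_cancel (h1.symm.trans h2)

lemma ext_of_eqLocus {ρ ρ' : HopfAction ℂ (Taft n m q) A} (h : ∀ a, a ∈ eqLocus ρ ρ') :
    ρ = ρ' := by
  refine HopfAction.ext (algHom_ext ?_ ?_)
  · exact LinearMap.ext fun a => (h a).2
  · exact LinearMap.ext fun a => (h a).1

end Taft

/-! ### The inner skew derivation and the action it defines -/

namespace CyclicAlg

variable {n m : ℕ} {q ζ : ℂ}

/-- The operator `a ↦ c a - G(a) c` through which `x` acts, for `G` the action of `g`. -/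
noncomputable def skewDer (hζ : IsPrimitiveRoot ζ n) (N : ℕ) :
    CyclicAlg n ζ →ₗ[RatUV] CyclicAlg n ζ :=
  LinearMap.mulLeft RatUV (c n ζ) -
    LinearMap.mulRight RatUV (c n ζ) ∘ₗ (scale n ζ hζ N 1).toLinearMap

section skewDer

variable (hζ : IsPrimitiveRoot ζ n) (N : ℕ)

lemma skewDer_apply (a : CyclicAlg n ζ) :
    skewDer hζ N a = c n ζ * a - scale n ζ hζ N 1 a * c n ζ := rfl

/-- Insert and subtract `G(a) c b` in `c a b - G(a) G(b) c`. -/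
lemma skewDer_mul (a b : CyclicAlg n ζ) : skewDer hζ N (a * b) =
    skewDer hζ N a * b + scale n ζ hζ N 1 a * skewDer hζ N b := by
  simp only [skewDer_apply, map_mul]
  noncomm_ring

lemma scale_pow_mon (k i j : ℕ) : ((scale n ζ hζ N 1).toLinearMap ^ k) (mon n ζ i j) =
    ((ζ ^ N) ^ i * ζ ^ j) ^ k • mon n ζ i j := by
  induction k with
  | zero => simp
  | succ k ih =>
    rw [pow_succ', Module.End.mul_apply, ih, ← algebraMap_smul RatUV, map_smul,
      AlgHom.toLinearMap_apply, scale_mon, algebraMap_smul, smul_smul, pow_one, pow_succ]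

variable [NeZero n]

/-- The factor `ζ ^ j` produced by `scale` on `w ^ j` cancels the `ζ⁻¹ ^ j` from moving `c` past `w
^ j`, leaving a coefficient that depends on `i` alone. -/
lemma skewDer_mon (i j : ℕ) :
    skewDer hζ N (mon n ζ i j) = (1 - (ζ ^ N) ^ i) • mon n ζ (i + 1) j := by
  have h0 := hζ.ne_zero (NeZero.ne n)
  have h1 := mon_mul_mon (n := n) h0 i j 1 0
  rw [skewDer_apply, c_mul_mon, scale_mon, smul_mul_assoc,
    show c n ζ = mon n ζ 1 0 by simp [mon], h1, smul_smul, sub_smul, one_smul, one_mul, pow_one,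
    mul_assoc, ← mul_pow, mul_inv_cancel₀ h0, one_pow, mul_one, add_zero]

lemma skewDer_pow_mon (k i j : ℕ) : (skewDer hζ N ^ k) (mon n ζ i j) =
    (∏ l ∈ Finset.range k, (1 - (ζ ^ N) ^ (i + l))) • mon n ζ (i + k) j := by
  induction k with
  | zero => simp
  | succ k ih =>
    rw [pow_succ', Module.End.mul_apply, ih, ← algebraMap_smul RatUV, map_smul, skewDer_mon,
      algebraMap_smul, smul_smul, Finset.prod_range_succ, add_assoc]

end skewDer

lemma restrictScalars_pow {V : Type*} [AddCommGroup V] [Module RatUV V] [Module ℂ V]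
    [IsScalarTower ℂ RatUV V] (f : Module.End RatUV V) (k : ℕ) (a : V) :
    ((f.restrictScalars ℂ : Module.End ℂ V) ^ k) a = (f ^ k) a := by
  rw [Module.End.pow_apply, Module.End.pow_apply]
  rfl

variable [NeZero n] [Fact (m ∣ n)] [Fact (IsPrimitiveRoot q m)]

open Taft in
/-- An action of the Taft algebra on the cyclic algebra is determined by its values on `c`, `w`. -/
lemma action_ext {ρ ρ' : HopfAction ℂ (Taft n m q) (CyclicAlg n ζ)}
    (hc : c n ζ ∈ eqLocus ρ ρ') (hw : w n ζ ∈ eqLocus ρ ρ') : ρ = ρ' := by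
  refine ext_of_eqLocus fun a => ?_
  -- The locus is a priori only a `ℂ`-subalgebra. It contains `u = c ^ n` and `v = w ^ n`, hence all
  -- polynomials in them, and then fractions by closure under inverses.
  have hpoly : ∀ P : MvPolynomial (Fin 2) ℂ,
      algebraMap RatUV (CyclicAlg n ζ) (algebraMap _ RatUV P) ∈ eqLocus ρ ρ' := by
    intro P
    induction P using MvPolynomial.induction_on with
    | C a =>
      rw [← MvPolynomial.algebraMap_eq, ← IsScalarTower.algebraMap_apply ℂ,
        ← IsScalarTower.algebraMap_apply ℂ RatUV]
      exact Subalgebra.algebraMap_mem _ _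
    | add P R hP hR => rw [map_add, map_add]; exact add_mem hP hR
    | mul_X P k hP =>
      rw [map_mul, map_mul]
      refine mul_mem hP ?_
      fin_cases k
      · change algebraMap RatUV _ RatUV.u ∈ _
        exact c_pow (n := n) (ζ := ζ) ▸ pow_mem hc n
      · change algebraMap RatUV _ RatUV.v ∈ _
        exact w_pow (n := n) (ζ := ζ) ▸ pow_mem hw n
  induction a using CyclicAlg.induction with
  | halg r =>
    obtain ⟨P, R, hR, rfl⟩ := IsFractionRing.div_surjective (MvPolynomial (Fin 2) ℂ) r
    have hR0 : algebraMap _ RatUV R ≠ 0 := IsFractionRing.to_map_ne_zero_of_mem_nonZeroDivisors hR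
    rw [div_eq_mul_inv, map_mul]
    refine mul_mem (hpoly P) (mem_eqLocus_of_mul_eq_one ?_ ?_ (hpoly R))
    · rw [← map_mul, mul_inv_cancel₀ hR0, map_one]
    · rw [← map_mul, inv_mul_cancel₀ hR0, map_one]
  | hc => exact hc
  | hw => exact hw
  | hmul a b ha hb => exact mul_mem ha hb
  | hadd a b ha hb => exact add_mem ha hb

/-- Two `ℂ(u, v)`-linear operators agree when they agree on monomials. -/
lemma linearMap_ext {V : Type*} [AddCommGroup V] [Module RatUV V] [Module ℂ V]
    [IsScalarTower ℂ RatUV V] (hζ : ζ ≠ 0) {f f' : CyclicAlg n ζ →ₗ[RatUV] V}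
    (h : ∀ i j, f (mon n ζ i j) = f' (mon n ζ i j)) : f = f' := by
  refine LinearMap.ext_on_range (span_mon hζ) fun p => h _ _

variable (m) in
/-- The action of the Taft algebra on the cyclic algebra. -/
noncomputable def taftAction (hζ : IsPrimitiveRoot ζ n) (hζq : ζ ^ (n / m) = q) :
    HopfAction ℂ (Taft n m q) (CyclicAlg n ζ) :=
  Taft.actionOfSkewDerivation ((skewDer hζ (n / m)).restrictScalars ℂ)
    ((scale n ζ hζ (n / m) 1).restrictScalars ℂ)
    (by
      have hq : IsPrimitiveRoot q m := Fact.out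
      ext a
      rw [restrictScalars_pow]
      have : skewDer hζ (n / m) ^ m = 0 := by
        refine linearMap_ext (hζ.ne_zero (NeZero.ne n)) fun i j => ?_
        rw [skewDer_pow_mon, hζq, LinearMap.zero_apply]
        have hm : 0 < m := Nat.pos_of_dvd_of_pos (Fact.out : m ∣ n) (NeZero.pos n)
        -- One of `m` consecutive exponents is divisible by `m`, and its factor `1 - q ^ (i + l)`
        -- vanishes. The outer `% m` in the witness covers the case `m ∣ i`.
        obtain ⟨l, hl, hil⟩ : ∃ l < m, m ∣ i + l := by
          refine ⟨(m - i % m) % m, Nat.mod_lt _ hm, ?_⟩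
          rw [Nat.dvd_iff_mod_eq_zero, Nat.add_mod, Nat.mod_mod, ← Nat.add_mod_mod,
            Nat.mod_mod, Nat.add_mod_mod, Nat.add_sub_cancel' (Nat.mod_lt i hm).le, Nat.mod_self]
        rw [Finset.prod_eq_zero (Finset.mem_range.2 hl), zero_smul]
        rw [(hq.pow_eq_one_iff_dvd _).2 hil, sub_self]
      rw [this]
      rfl)
    (by
      ext a
      have : (scale n ζ hζ (n / m) 1).toLinearMap ^ n = 1 := by
        refine linearMap_ext (hζ.ne_zero (NeZero.ne n)) fun i j => ?_
        rw [scale_pow_mon, ← pow_mul, ← pow_add, ← pow_mul, mul_comm, pow_mul, hζ.pow_eq_one,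
          one_pow, one_smul, Module.End.one_apply]
      exact (restrictScalars_pow (scale n ζ hζ (n / m) 1).toLinearMap n a).trans (by rw [this]; rfl))
    (by
      ext a
      -- `skewDer` raises the exponent of `c` by one, which multiplies the eigenvalue of `G` by `q`.
      have : (scale n ζ hζ (n / m) 1).toLinearMap ∘ₗ skewDer hζ (n / m) =
          q • (skewDer hζ (n / m) ∘ₗ (scale n ζ hζ (n / m) 1).toLinearMap) := by
        refine linearMap_ext (hζ.ne_zero (NeZero.ne n)) fun i j => ?_
        simp only [LinearMap.comp_apply, LinearMap.smul_apply, AlgHom.toLinearMap_apply,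
          skewDer_mon, scale_mon]
        rw [← AlgHom.toLinearMap_apply, LinearMap.map_smul_of_tower,
          LinearMap.map_smul_of_tower, skewDer_mon, AlgHom.toLinearMap_apply, scale_mon]
        simp only [smul_smul, hζq]
        congr 1
        ring
      exact LinearMap.congr_fun this a)
    (skewDer_mul hζ _)

section taftAction

variable (hζ : IsPrimitiveRoot ζ n) (hζq : ζ ^ (n / m) = q)

lemma taftAction_g (a : CyclicAlg n ζ) :
    (taftAction m hζ hζq).act (Taft.g n m q) a = scale n ζ hζ (n / m) 1 a := by
  exact Taft.actionOfSkewDerivation_g ..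

lemma taftAction_x (a : CyclicAlg n ζ) :
    (taftAction m hζ hζq).act (Taft.x n m q) a = skewDer hζ (n / m) a := by
  exact Taft.actionOfSkewDerivation_x ..

/-- The action is `ℂ(u, v)`-linear. -/
lemma taftAction_smul (h : Taft n m q) (r : RatUV) (a : CyclicAlg n ζ) :
    (taftAction m hζ hζq).act h (r • a) = r • (taftAction m hζ hζq).act h a := by
  induction h using Taft.induction generalizing a with
  | halg s => rw [AlgHom.commutes, Module.algebraMap_end_apply, Module.algebraMap_end_apply,
      smul_comm]
  | hx => rw [taftAction_x, taftAction_x, map_smul]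
  | hg => rw [taftAction_g, taftAction_g, map_smul]
  | hmul a b ha hb =>
    rw [map_mul, Module.End.mul_apply, Module.End.mul_apply, hb, ha]
  | hadd a b ha hb =>
    rw [map_add, LinearMap.add_apply, LinearMap.add_apply, ha, hb, smul_add]

lemma taftAction_x_pow_mul_g_pow_mon (a b i j : ℕ) :
    (taftAction m hζ hζq).act (Taft.x n m q ^ a * Taft.g n m q ^ b) (mon n ζ i j) =
      ((q ^ i * ζ ^ j) ^ b * ∏ l ∈ Finset.range a, (1 - q ^ (i + l))) • mon n ζ (i + a) j := by
  have hg : (taftAction m hζ hζq).act (Taft.g n m q) =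
      (scale n ζ hζ (n / m) 1).toLinearMap.restrictScalars ℂ :=
    LinearMap.ext fun a => taftAction_g hζ hζq a
  have hx : (taftAction m hζ hζq).act (Taft.x n m q) = (skewDer hζ (n / m)).restrictScalars ℂ :=
    LinearMap.ext fun a => taftAction_x hζ hζq a
  rw [map_mul, map_pow, map_pow, Module.End.mul_apply, hg, hx, restrictScalars_pow,
    restrictScalars_pow, scale_pow_mon, ← algebraMap_smul RatUV, map_smul, skewDer_pow_mon,
    algebraMap_smul, smul_smul, hζq]

end taftAction

end CyclicAlg

/-! ### Hopf-Galois extensions and faithfulness -/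

namespace HopfAction

variable {k H A : Type*} [Field k] [Ring H] [HopfAlgebra k H] [Ring A] [Algebra k A]
  (ρ : HopfAction k H A)

/-- The action is linear over invariants, so `a (h · b) = h · 1 = ε(h) a b`, and `a` cancels. -/
lemma mem_invariants_of_mul_eq_one {a b : A} (ha : a ∈ ρ.invariants) (hab : a * b = 1)
    (hba : b * a = 1) : b ∈ ρ.invariants := by
  intro h
  have h1 := ρ.act_mul_of_invariant h ha b
  rw [hab, ρ.act_one, Algebra.algebraMap_eq_smul_one, ← hab, ← mul_smul_comm] at h1
  have h2 := congrArg (b * ·) h1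
  simp only [← mul_assoc, hba, one_mul] at h2
  exact h2.symm

variable (H A) in
/-- Evaluation of the second tensor factor at an element of `H`. -/
noncomputable def evalDual (h : H) : A ⊗[k] Module.Dual k H →ₗ[k] A :=
  LinearMap.applyₗ h ∘ₗ dualTensorHom k H A ∘ₗ
    (TensorProduct.comm k A (Module.Dual k H)).toLinearMap

lemma evalDual_tmul (h : H) (a : A) (f : Module.Dual k H) :
    evalDual H A h (a ⊗ₜ[k] f) = f h • a := by
  simp [evalDual]

variable [Module.Finite k H]

/-- This turns statements about the canonical map into statements about the action. -/
lemma evalDual_preCan_tmul (h : H) (a a' : A) :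
    evalDual H A h (ρ.preCan (a ⊗ₜ[k] a')) = a * ρ.act h a' := by
  rw [preCan_tmul, ← (ρ.coaction_eq_iff a' _).1 rfl h]
  induction ρ.coaction a' using TensorProduct.induction_on with
  | zero => simp
  | tmul x f => simp [evalDual]
  | add s t hs ht => simp only [map_add, LinearMap.add_apply, hs, ht, mul_add]

/-- A Hopf-Galois extension of a nonzero algebra has a faithful action. -/
lemma IsHopfGalois.eq_zero_of_act_eq_zero [Nontrivial A] {ρ : HopfAction k H A}
    (hρ : ρ.IsHopfGalois) {h : H} (hh : ρ.act h = 0) : h = 0 := by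
  refine (Module.forall_dual_apply_eq_zero_iff k h).1 fun f => ?_
  -- Evaluating a preimage of `1 ⊗ f` at an element `h` that acts by zero gives `f h • 1 = 0`, for
  -- every functional `f`.
  obtain ⟨y, hy⟩ := hρ.2 ((1 : A) ⊗ₜ[k] f)
  obtain ⟨t, rfl⟩ := Submodule.mkQ_surjective _ y
  have hy' : ρ.preCan t = 1 ⊗ₜ[k] f := hy
  have ht : evalDual H A h (ρ.preCan t) = 0 := by
    clear hy hy'
    induction t using TensorProduct.induction_on with
    | zero => simp
    | tmul a a' => rw [evalDual_preCan_tmul, hh, LinearMap.zero_apply, mul_zero]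
    | add s t hs ht => rw [map_add, map_add, hs, ht, add_zero]
  rw [hy', evalDual_tmul] at ht
  exact (smul_eq_zero_iff_left one_ne_zero).1 ht

lemma IsHopfGalois.innerFaithful [Nontrivial A] {ρ : HopfAction k H A} (hρ : ρ.IsHopfGalois) :
    ρ.InnerFaithful := fun _ _ _ hI =>
  (Submodule.eq_bot_iff _).2 fun h hh => hρ.eq_zero_of_act_eq_zero (hI h hh)

end HopfAction

/-! ### Dimension bound for the Taft algebra; invariance tested on generators -/

namespace Taft

variable {n m : ℕ} {q : ℂ}

lemma g_pow_mul_x_pow (i j : ℕ) :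
    g n m q ^ j * x n m q ^ i = q ^ (i * j) • (x n m q ^ i * g n m q ^ j) := by
  have h1 : ∀ i, g n m q * x n m q ^ i = q ^ i • (x n m q ^ i * g n m q) := by
    intro i
    induction i with
    | zero => simp
    | succ i ih =>
      rw [pow_succ, ← mul_assoc, ih, smul_mul_assoc, mul_assoc, g_mul_x, mul_smul_comm, smul_smul,
        ← pow_succ, mul_assoc]
  induction j with
  | zero => simp
  | succ j ih =>
    rw [pow_succ, mul_assoc, h1, mul_smul_comm, ← mul_assoc, ih, smul_mul_assoc, smul_smul,
      ← pow_add, mul_assoc, ← pow_succ, Nat.mul_succ, add_comm i]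

lemma span_x_pow_mul_g_pow [NeZero n] : Submodule.span ℂ (Set.range
    fun p : Fin m × Fin n => x n m q ^ (p.1 : ℕ) * g n m q ^ (p.2 : ℕ)) = ⊤ := by
  set S := Submodule.span ℂ (Set.range
    fun p : Fin m × Fin n => x n m q ^ (p.1 : ℕ) * g n m q ^ (p.2 : ℕ)) with hS
  have mem : ∀ i j : ℕ, x n m q ^ i * g n m q ^ j ∈ S := by
    intro i j
    by_cases hi : i < m
    · rw [← Nat.mod_add_div j n, pow_add, pow_mul, g_pow, one_pow, mul_one]
      exact Submodule.subset_span ⟨(⟨i, hi⟩, ⟨j % n, Nat.mod_lt _ (NeZero.pos n)⟩), rfl⟩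
    · rw [pow_eq_zero_of_le (not_lt.1 hi) x_pow, zero_mul]
      exact S.zero_mem
  have hmul : ∀ a ∈ S, ∀ b ∈ S, a * b ∈ S := by
    intro a ha b hb
    have := Submodule.mul_mem_mul ha hb
    rw [hS, Submodule.span_mul_span] at this
    refine Submodule.span_le.2 ?_ this
    rintro _ ⟨_, ⟨p, rfl⟩, _, ⟨r, rfl⟩, rfl⟩
    have e : x n m q ^ (p.1 : ℕ) * g n m q ^ (p.2 : ℕ) * (x n m q ^ (r.1 : ℕ) * g n m q ^ (r.2 : ℕ))
        = q ^ ((r.1 : ℕ) * p.2) • (x n m q ^ (p.1 + r.1 : ℕ) * g n m q ^ (p.2 + r.2 : ℕ)) := by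
      rw [mul_assoc, ← mul_assoc (g n m q ^ (p.2 : ℕ)), g_pow_mul_x_pow, smul_mul_assoc,
        mul_smul_comm, pow_add, pow_add]
      simp only [mul_assoc]
    exact (congrArg (· ∈ S) e).mpr (S.smul_mem _ (mem _ _))
  clear_value S
  refine eq_top_iff.2 fun a _ => ?_
  induction a using Taft.induction with
  | halg r =>
    rw [Algebra.algebraMap_eq_smul_one]
    exact S.smul_mem _ (by simpa using mem 0 0)
  | hx => simpa using mem 1 0
  | hg => simpa using mem 0 1
  | hmul a b ha hb => exact hmul a (ha trivial) b (hb trivial)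
  | hadd a b ha hb => exact S.add_mem (ha trivial) (hb trivial)

/-- This upper bound suffices for the dimension count in `canSum_surjective`. -/
lemma finrank_le [NeZero n] : Module.finrank ℂ (Taft n m q) ≤ m * n := by
  rw [← finrank_top, ← span_x_pow_mul_g_pow]
  exact (finrank_range_le_card _).trans (by simp)

variable [NeZero n] [Fact (m ∣ n)] [Fact (IsPrimitiveRoot q m)]

lemma mem_invariants_of_generators {A : Type*} [Ring A] [Algebra ℂ A]
    {ρ : HopfAction ℂ (Taft n m q) A} {a : A} (hg : ρ.act (g n m q) a = a)
    (hx : ρ.act (x n m q) a = 0) : a ∈ ρ.invariants := by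
  intro h
  induction h using Taft.induction with
  | halg r => rw [AlgHom.commutes, Bialgebra.counit_algebraMap, Module.algebraMap_end_apply]
  | hx => rw [hx, counit_x, zero_smul]
  | hg => rw [hg, counit_g, one_smul]
  | hmul b c hb hc =>
    rw [map_mul, Module.End.mul_apply, hc, map_smul, hb, Bialgebra.counit_mul, smul_smul, mul_comm]
  | hadd b c hb hc => rw [map_add, LinearMap.add_apply, hb, hc, map_add, add_smul]

end Taft

namespace CyclicAlg

variable {n m : ℕ} {q ζ : ℂ} [NeZero n] [Fact (m ∣ n)] [Fact (IsPrimitiveRoot q m)]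
  (hζ : IsPrimitiveRoot ζ n) (hζq : ζ ^ (n / m) = q)

/-! ### The invariants -/

lemma c_pow_mem_invariants : c n ζ ^ m ∈ (taftAction m hζ hζq).invariants := by
  have hq : IsPrimitiveRoot q m := Fact.out
  have h1 : c n ζ ^ m = mon n ζ m 0 := by simp [mon]
  refine Taft.mem_invariants_of_generators ?_ ?_
  · rw [h1, taftAction_g, scale_mon, hζq, hq.pow_eq_one]
    simp
  · rw [h1, taftAction_x, skewDer_mon, hζq, hq.pow_eq_one, sub_self, zero_smul]

lemma smul_mem_invariants (r : RatUV) {a : CyclicAlg n ζ}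
    (ha : a ∈ (taftAction m hζ hζq).invariants) : r • a ∈ (taftAction m hζ hζq).invariants := by
  intro h
  rw [taftAction_smul, ha, smul_comm]

/-- No two monomials mix: `x` kills `c ^ i * w ^ j` exactly when `m ∣ i`, and then `g` scales it by
`ζ ^ j`, which forces `j = 0`. -/
lemma coe_invariants_eq_adjoin : ((taftAction m hζ hζq).invariants : Set (CyclicAlg n ζ)) =
    Algebra.adjoin RatUV {c n ζ ^ m} := by
  have hq : IsPrimitiveRoot q m := Fact.out
  refine Set.Subset.antisymm (fun a ha => ?_) (fun a ha => ?_)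
  · have hg := ha (Taft.g n m q)
    have hx := ha (Taft.x n m q)
    rw [Taft.counit_g, one_smul, taftAction_g] at hg
    rw [Taft.counit_x, zero_smul, taftAction_x] at hx
    obtain ⟨r, rfl⟩ := exists_eq_sum_mon hζ a
    refine Subalgebra.sum_mem _ fun p _ => ?_
    by_cases hp : r p = 0
    · rw [hp, zero_smul]; exact zero_mem _
    have hpx : (1 - q ^ (p.1 : ℕ) : ℂ) = 0 := by
      by_contra hne
      refine hp (coeff_eq_zero_of_sum_smul_eq_zero hζ (e := fun p => 1 - q ^ (p.1 : ℕ)) ?_ hne)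
      -- Multiplication by the unit `c` matches the shift of exponent caused by `x`.
      refine isUnit_c.mul_left_cancel ?_
      rw [mul_zero, ← hx, map_sum, Finset.mul_sum]
      refine Finset.sum_congr rfl fun p _ => ?_
      rw [map_smul, skewDer_mon, mul_smul_comm, mul_smul_comm, c_mul_mon, hζq]
    have hpq : q ^ (p.1 : ℕ) = 1 := (sub_eq_zero.1 hpx).symm
    have hpg : (q ^ (p.1 : ℕ) * ζ ^ (p.2 : ℕ) - 1 : ℂ) = 0 := by
      by_contra hne
      refine hp (coeff_eq_zero_of_sum_smul_eq_zero hζ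
        (e := fun p => q ^ (p.1 : ℕ) * ζ ^ (p.2 : ℕ) - 1) ?_ hne)
      simp only [sub_smul, smul_sub, Finset.sum_sub_distrib, one_smul]
      rw [sub_eq_zero]
      conv_rhs => rw [← hg]
      rw [map_sum]
      refine Finset.sum_congr rfl fun p _ => ?_
      rw [map_smul, scale_mon, hζq, pow_one]
    rw [hpq, one_mul, sub_eq_zero] at hpg
    have h2 : (p.2 : ℕ) = 0 := by
      by_contra h0
      exact hζ.pow_ne_one_of_pos_of_lt h0 p.2.2 hpg
    obtain ⟨s, hs⟩ := (hq.pow_eq_one_iff_dvd _).1 hpq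
    rw [mon, h2, hs, pow_zero, mul_one, pow_mul]
    exact Subalgebra.smul_mem _ (pow_mem (Algebra.subset_adjoin (Set.mem_singleton _)) s) (r p)
  · induction ha using Algebra.adjoin_induction with
    | mem a ha => rw [Set.mem_singleton_iff.1 ha]; exact c_pow_mem_invariants hζ hζq
    | algebraMap r =>
      rw [Algebra.algebraMap_eq_smul_one]
      exact smul_mem_invariants hζ hζq r (one_mem _)
    | add a b _ _ ha hb => exact add_mem ha hb
    | mul a b _ _ ha hb => exact mul_mem ha hb

/-- Commutativity comes from generation by one element over the centre; inverses taken in `Q` stay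
invariant. -/
lemma isField_invariants : IsField (taftAction m hζ hζq).invariants where
  exists_pair_ne := by
    have := nontrivial hζ
    exact exists_pair_ne _
  mul_comm := by
    rintro ⟨a, ha⟩ ⟨b, hb⟩
    rw [← SetLike.mem_coe, coe_invariants_eq_adjoin] at ha hb
    have := Algebra.commute_of_mem_adjoin_of_forall_mem_commute (R := RatUV) (s := {c n ζ ^ m})
      (a := a) (b := b) hb ?_
    · exact Subtype.ext this
    · rintro d rfl
      exact (Algebra.commute_of_mem_adjoin_self ha).symm
  mul_inv_cancel := by
    rintro ⟨a, ha⟩ h0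
    obtain ⟨u, rfl⟩ := isUnit_of_ne_zero hζ (a := a) fun h => h0 (Subtype.ext h)
    exact ⟨⟨_, HopfAction.mem_invariants_of_mul_eq_one _ ha u.mul_inv u.inv_mul⟩,
      Subtype.ext u.mul_inv⟩

/-! ### The Galois property -/

/-- The cyclic algebra is spanned over the invariants by the `c ^ (i + 1) * w ^ j` with `i < m` and
`j < n`. -/
lemma exists_eq_sum_invariants_mul (a : CyclicAlg n ζ) : ∃ b : Fin m × Fin n → CyclicAlg n ζ,
    (∀ p, b p ∈ (taftAction m hζ hζq).invariants) ∧ a = ∑ p, b p * mon n ζ (p.1 + 1) p.2 := by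
  have hm : 0 < m := Nat.pos_of_dvd_of_pos (Fact.out : m ∣ n) (NeZero.pos n)
  have ha : a ∈ Submodule.span RatUV (Set.range fun p : Fin n × Fin n => mon n ζ p.1 p.2) := by
    rw [span_mon (hζ.ne_zero (NeZero.ne n))]; trivial
  induction ha using Submodule.span_induction with
  | mem a ha =>
    obtain ⟨⟨i, j⟩, rfl⟩ := ha
    -- As `u⁻¹ c ^ n = 1`, replace `i` by `i + n ≥ 1` and divide `i + n - 1` by `m`: the remainder
    -- plus one is the exponent of `c` left over, lying in `1, ..., m`.
    let p₀ : Fin m × Fin n := (⟨(i + n - 1) % m, Nat.mod_lt _ hm⟩, j)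
    refine ⟨Pi.single p₀ (RatUV.u⁻¹ • (c n ζ ^ m) ^ ((i + n - 1) / m)), fun p => ?_, ?_⟩
    · rw [Pi.single_apply]
      split_ifs
      · exact smul_mem_invariants hζ hζq _ (pow_mem (c_pow_mem_invariants hζ hζq) _)
      · exact zero_mem _
    · rw [Finset.sum_eq_single_of_mem p₀ (Finset.mem_univ _) fun p _ hp => by
        rw [Pi.single_eq_of_ne hp, zero_mul], Pi.single_eq_same]
      have h1 : m * ((i + n - 1) / m) + ((i + n - 1) % m + 1) = i + n := by
        have := Nat.div_add_mod (i + n - 1) m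
        have := NeZero.pos n
        omega
      have h2 := mon_add_mul (n := n) (ζ := ζ) i j 1 0
      rw [smul_mul_assoc, mon, ← mul_assoc, ← pow_mul, ← pow_add, h1, ← mon,
        eq_inv_smul_iff₀ RatUV.u_ne_zero]
      rwa [pow_one, pow_zero, mul_one, mul_one, mul_zero, add_zero, eq_comm] at h2
  | zero => exact ⟨0, fun _ => zero_mem _, by simp⟩
  | add a b _ _ ha hb =>
    obtain ⟨f, hf, rfl⟩ := ha
    obtain ⟨g, hg, rfl⟩ := hb
    exact ⟨f + g, fun p => add_mem (hf p) (hg p), by simp [add_mul, Finset.sum_add_distrib]⟩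
  | smul r a _ ha =>
    obtain ⟨f, hf, rfl⟩ := ha
    exact ⟨r • f, fun p => smul_mem_invariants hζ hζq r (hf p), by
      simp [Finset.smul_sum]⟩

/-- Invariant coefficients of the right factor move across the balanced tensor product into the left
factor. -/
lemma exists_sub_sum_mem_balancedRel (t : CyclicAlg n ζ ⊗[ℂ] CyclicAlg n ζ) :
    ∃ f : Fin m × Fin n → CyclicAlg n ζ, t - ∑ p, f p ⊗ₜ[ℂ] mon n ζ (p.1 + 1) p.2 ∈
      balancedRel (taftAction m hζ hζq).invariants := by
  induction t using TensorProduct.induction_on with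
  | zero => exact ⟨0, by simp⟩
  | tmul a a' =>
    obtain ⟨b, hb, rfl⟩ := exists_eq_sum_invariants_mul hζ hζq a'
    refine ⟨fun p => a * b p, ?_⟩
    rw [TensorProduct.tmul_sum, ← Finset.sum_sub_distrib]
    refine Submodule.sum_mem _ fun p _ => ?_
    rw [← neg_sub]
    exact Submodule.neg_mem _ (Submodule.subset_span ⟨a, _, b p, hb p, rfl⟩)
  | add s t hs ht =>
    obtain ⟨f, hf⟩ := hs
    obtain ⟨g, hg⟩ := ht
    refine ⟨f + g, ?_⟩
    simp only [Pi.add_apply, TensorProduct.add_tmul, Finset.sum_add_distrib]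
    rw [add_sub_add_comm]
    exact Submodule.add_mem _ hf hg

/-- Elements of `Q ⊗ (span of the c ^ (i + 1) * w ^ j)` are detected by the Taft algebra. -/
lemma eq_zero_of_sum_mul_act_eq_zero {f : Fin m × Fin n → CyclicAlg n ζ}
    (h : ∀ a b : ℕ, ∑ p, f p * (taftAction m hζ hζq).act (Taft.x n m q ^ a * Taft.g n m q ^ b)
      (mon n ζ (p.1 + 1) p.2) = 0) : f = 0 := by
  have hq : IsPrimitiveRoot q m := Fact.out
  have h0 := hζ.ne_zero (NeZero.ne n)
  have hm : 0 < m := Nat.pos_of_dvd_of_pos (Fact.out : m ∣ n) (NeZero.pos n)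
  have hq0 := hq.ne_zero hm.ne'
  let B : Fin m × Fin n → CyclicAlg n ζ := fun p => f p * mon n ζ (p.1 + 1) p.2
  let P : ℕ → ℕ → ℂ := fun i a => ∏ l ∈ Finset.range a, (1 - q ^ (i + 1 + l))
  -- Moving `c ^ a` to the right of `w ^ j` costs `ζ ^ (a * j)`; afterwards `c ^ a` is a common
  -- right factor and cancels.
  have h1 : ∀ a b : ℕ, ∑ i : Fin m, ∑ j : Fin n,
      ((q ^ (i + 1 : ℕ) * ζ ^ (j : ℕ)) ^ b * P i a * ζ ^ (a * j : ℕ)) • B (i, j) = 0 := by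
    intro a b
    refine (isUnit_c.pow a).mul_right_cancel ?_
    rw [zero_mul, ← h a b, Fintype.sum_prod_type, Finset.sum_mul]
    refine Finset.sum_congr rfl fun i _ => ?_
    rw [Finset.sum_mul]
    refine Finset.sum_congr rfl fun j _ => ?_
    have h2 : c n ζ ^ a = mon n ζ a 0 := by simp [mon]
    rw [taftAction_x_pow_mul_g_pow_mon, smul_mul_assoc, h2]
    simp only [B]
    rw [mul_assoc (f _), mon_mul_mon h0,
      mul_smul_comm, mul_smul_comm, smul_smul, add_zero, mul_assoc _ _ ((ζ⁻¹) ^ _), ← mul_pow,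
      mul_inv_cancel₀ h0, one_pow, mul_one]
  -- Induction on `i` with `a = m - 1 - i`. Smaller indices vanish by induction. For larger ones the
  -- product `P` reaches the exponent `m` and is zero; for `i` itself it stops at `m - 1` and is
  -- not.
  have h2 : ∀ i : ℕ, ∀ hi : i < m, ∀ j, B (⟨i, hi⟩, j) = 0 := by
    intro i
    induction i using Nat.strong_induction_on with
    | _ i ih =>
      intro hi j
      have hP : P i (m - 1 - i) ≠ 0 := by
        refine Finset.prod_ne_zero_iff.2 fun l hl => sub_ne_zero.2 fun e => ?_
        rw [Finset.mem_range] at hl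
        exact hq.pow_ne_one_of_pos_of_lt (by omega) (by omega) e.symm
      -- With `i` isolated, varying `b` gives a Vandermonde system with the distinct nodes `ζ ^ j`.
      have h3 := eq_zero_of_sum_pow_smul_eq_zero Finset.univ (hζ.injective_pow_fin.injOn)
        (fun j : Fin n => (P i (m - 1 - i) * ζ ^ ((m - 1 - i) * j : ℕ)) • B (⟨i, hi⟩, j)) (by
          intro b
          have h4 := h1 (m - 1 - i) b
          rw [Finset.sum_eq_single_of_mem ⟨i, hi⟩ (Finset.mem_univ _)] at h4
          · refine (smul_eq_zero_iff_right (pow_ne_zero b (pow_ne_zero (i + 1) hq0))).1 ?_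
            rw [← h4, Finset.smul_sum]
            refine Finset.sum_congr rfl fun j _ => ?_
            rw [smul_smul, smul_smul, mul_pow]
            congr 1
            ring
          · intro i' _ hne
            refine Finset.sum_eq_zero fun j _ => ?_
            rcases lt_or_gt_of_ne (fun e => hne (Fin.ext e) : (i' : ℕ) ≠ i) with hlt | hlt
            · rw [ih i' hlt i'.2 j, smul_zero]
            · have hP0 : P i' (m - 1 - i) = 0 := by
                have hi' := i'.2
                refine Finset.prod_eq_zero (i := m - 1 - i') (Finset.mem_range.2 (by omega)) ?_
                rw [show (i' + 1 + (m - 1 - i') : ℕ) = m by omega, hq.pow_eq_one, sub_self]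
              rw [hP0, mul_zero, zero_mul, zero_smul]) j (Finset.mem_univ j)
      exact (smul_eq_zero_iff_right (mul_ne_zero hP (pow_ne_zero _ h0))).1 h3
  funext p
  exact (isUnit_mon _ _).mul_left_eq_zero.1 (h2 p.1 p.1.2 p.2)

/-- The map `(a_{i j}) ↦ can (∑ a_{i j} ⊗ c ^ (i + 1) * w ^ j)`. -/
noncomputable def canSum : (Fin m × Fin n → CyclicAlg n ζ) →ₗ[RatUV]
    CyclicAlg n ζ ⊗[ℂ] Module.Dual ℂ (Taft n m q) where
  toFun f := ∑ p, (taftAction m hζ hζq).preCan (f p ⊗ₜ[ℂ] mon n ζ (p.1 + 1) p.2)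
  map_add' f g := by
    simp only [Pi.add_apply, TensorProduct.add_tmul, map_add, Finset.sum_add_distrib]
  map_smul' r f := by
    rw [Finset.smul_sum]
    refine Finset.sum_congr rfl fun p _ => ?_
    rw [HopfAction.preCan_tmul, HopfAction.preCan_tmul]
    induction (taftAction m hζ hζq).coaction (mon n ζ (p.1 + 1) p.2) using
      TensorProduct.induction_on with
    | zero => simp
    | tmul a φ => simp [TensorProduct.smul_tmul']
    | add s t hs ht => simp only [map_add, hs, ht, smul_add]

lemma canSum_apply (f : Fin m × Fin n → CyclicAlg n ζ) : canSum hζ hζq f =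
    (taftAction m hζ hζq).preCan (∑ p, f p ⊗ₜ[ℂ] mon n ζ (p.1 + 1) p.2) := by
  rw [map_sum]; rfl

lemma canSum_injective : Function.Injective (canSum hζ hζq) := by
  refine (injective_iff_map_eq_zero _).2 fun f hf => ?_
  refine eq_zero_of_sum_mul_act_eq_zero hζ hζq fun a b => ?_
  have := congrArg (HopfAction.evalDual _ _ (Taft.x n m q ^ a * Taft.g n m q ^ b)) hf
  rw [canSum_apply, map_sum, map_sum, map_zero] at this
  simpa only [HopfAction.evalDual_preCan_tmul] using this

/-- Over `ℂ(u, v)` the source has dimension `m n · n ^ 2` and the target at most that, so an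
injective map is onto. -/
lemma canSum_surjective : Function.Surjective (canSum hζ hζq) := by
  have := moduleFinite hζ
  have : Module.Finite RatUV (CyclicAlg n ζ ⊗[ℂ] Module.Dual ℂ (Taft n m q)) :=
    .of_basis ((monBasis n ζ hζ).tensorProduct (Module.finBasis ℂ _))
  rw [← LinearMap.range_eq_top]
  refine Submodule.eq_top_of_finrank_eq (le_antisymm (Submodule.finrank_le _) ?_)
  rw [LinearMap.finrank_range_of_inj (canSum_injective hζ hζq), Module.finrank_tensorProduct,
    Subspace.dual_finrank_eq, Module.finrank_pi_fintype, Finset.sum_const, Finset.card_univ,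
    smul_eq_mul, mul_comm]
  exact Nat.mul_le_mul_right _ (Taft.finrank_le.trans (by simp))

/-- Every class in the balanced tensor product is represented by some `∑ f p ⊗ c ^ (i + 1) * w ^ j`,
on which the canonical map is `canSum`; bijectivity transfers. -/
theorem taftAction_isHopfGalois : (taftAction m hζ hζq).IsHopfGalois := by
  constructor
  · refine (injective_iff_map_eq_zero _).2 fun y hy => ?_
    obtain ⟨t, rfl⟩ := Submodule.mkQ_surjective _ y
    obtain ⟨f, hf⟩ := exists_sub_sum_mem_balancedRel hζ hζq t
    have h1 := HopfAction.balancedRel_le_ker _ hf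
    have hy' : (taftAction m hζ hζq).preCan t = 0 := hy
    rw [LinearMap.mem_ker, map_sub, hy', ← canSum_apply, zero_sub, neg_eq_zero] at h1
    rw [canSum_injective hζ hζq (h1.trans (map_zero _).symm)] at hf
    simpa using hf
  · intro y
    obtain ⟨f, rfl⟩ := canSum_surjective hζ hζq y
    exact ⟨Submodule.Quotient.mk _, (canSum_apply hζ hζq f).symm⟩

end CyclicAlg

/-! ### The main theorem -/

theorem proposition3p2 (n m : ℕ) [NeZero n] [Fact (m ∣ n)] (q ζ : ℂ)
    [Fact (IsPrimitiveRoot q m)] (hζ : IsPrimitiveRoot ζ n) (hζq : ζ ^ (n / m) = q) :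
    -- `Q(n, m)` is a central simple division algebra of degree `n` over `ℂ(u, v)`
    (Nontrivial (CyclicAlg n ζ) ∧ (∀ a : CyclicAlg n ζ, a ≠ 0 → IsUnit a) ∧
      Algebra.IsCentral RatUV (CyclicAlg n ζ) ∧
      Module.finrank RatUV (CyclicAlg n ζ) = n ^ 2) ∧
    -- it carries an action of `T(n, m, 0)` with the given values on the generators
    ∃ ρ : HopfAction ℂ (Taft n m q) (CyclicAlg n ζ),
      (ρ.act (Taft.g n m q) (CyclicAlg.c n ζ) = q • CyclicAlg.c n ζ ∧
        ρ.act (Taft.g n m q) (CyclicAlg.w n ζ) = ζ • CyclicAlg.w n ζ ∧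
        ρ.act (Taft.x n m q) (CyclicAlg.c n ζ) = (1 - q) • CyclicAlg.c n ζ ^ 2 ∧
        ρ.act (Taft.x n m q) (CyclicAlg.w n ζ) = 0) ∧
      -- which is the only action with these values
      (∀ ρ' : HopfAction ℂ (Taft n m q) (CyclicAlg n ζ),
        ρ'.act (Taft.g n m q) (CyclicAlg.c n ζ) = q • CyclicAlg.c n ζ →
        ρ'.act (Taft.g n m q) (CyclicAlg.w n ζ) = ζ • CyclicAlg.w n ζ →
        ρ'.act (Taft.x n m q) (CyclicAlg.c n ζ) = (1 - q) • CyclicAlg.c n ζ ^ 2 →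
        ρ'.act (Taft.x n m q) (CyclicAlg.w n ζ) = 0 → ρ' = ρ) ∧
      -- is inner faithful, and is Hopf-Galois
      ρ.InnerFaithful ∧
      ρ.IsHopfGalois ∧
      -- with invariants the subfield `ℂ(u, v)(c ^ m)`
      (ρ.invariants : Set (CyclicAlg n ζ)) = Algebra.adjoin RatUV {CyclicAlg.c n ζ ^ m} ∧
      IsField ρ.invariants := by
  refine ⟨⟨CyclicAlg.nontrivial hζ, fun a ha => CyclicAlg.isUnit_of_ne_zero hζ ha,
    CyclicAlg.isCentral hζ, CyclicAlg.finrank_eq hζ⟩, CyclicAlg.taftAction m hζ hζq, ?_⟩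
  have hgc : (CyclicAlg.taftAction m hζ hζq).act (Taft.g n m q) (CyclicAlg.c n ζ) =
      q • CyclicAlg.c n ζ := by
    rw [CyclicAlg.taftAction_g, CyclicAlg.scale_c, hζq]
  have hgw : (CyclicAlg.taftAction m hζ hζq).act (Taft.g n m q) (CyclicAlg.w n ζ) =
      ζ • CyclicAlg.w n ζ := by
    rw [CyclicAlg.taftAction_g, CyclicAlg.scale_w, pow_one]
  have hxc : (CyclicAlg.taftAction m hζ hζq).act (Taft.x n m q) (CyclicAlg.c n ζ) =
      (1 - q) • CyclicAlg.c n ζ ^ 2 := by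
    rw [CyclicAlg.taftAction_x, CyclicAlg.skewDer_apply, CyclicAlg.scale_c, hζq, smul_mul_assoc,
      ← sq, sub_smul, one_smul]
  have hxw : (CyclicAlg.taftAction m hζ hζq).act (Taft.x n m q) (CyclicAlg.w n ζ) = 0 := by
    rw [CyclicAlg.taftAction_x, CyclicAlg.skewDer_apply, CyclicAlg.scale_w, pow_one,
      smul_mul_assoc, CyclicAlg.c_mul_w, sub_self]
  have hG := CyclicAlg.taftAction_isHopfGalois hζ hζq
  have := CyclicAlg.nontrivial hζ
  refine ⟨⟨hgc, hgw, hxc, hxw⟩, fun ρ' h1 h2 h3 h4 => ?_, hG.innerFaithful, hG,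
    CyclicAlg.coe_invariants_eq_adjoin hζ hζq, CyclicAlg.isField_invariants hζ hζq⟩
  exact CyclicAlg.action_ext ⟨h1.trans hgc.symm, h3.trans hxc.symm⟩
    ⟨h2.trans hgw.symm, h4.trans hxw.symm⟩
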